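/- Let $k>0$, $r_o>0$, $B=\{x\in\mathbb R^2:|x|<r_o\}$, and let $\Omega\subset\mathbb R^2$ be a set with $\overline\Omega\subset B$ (for example a bounded Lipschitz obstacle). Let $J_n$, $Y_n$ ($n\in\mathbb Z$) be the Bessel and Neumann functions and $H^{(1)}_n=J_n+iY_n$ the Hankel functions of the first kind; let $\phi(x;y)=\frac i4 H^{(1)}_0(k|x-y|)$ be the fundamental solution of the Helmholtz equation in $\mathbb R^2$, and for $g\in L^2(\partial B)$ put $$(\mathrm Hg)(x)=\int_{\partial B}\phi(x;y)\,g(y)\,ds_y,\qquad x\in\partial\Omega .$$ Write $\theta_{xy}$ for the angle between $x$ and $y$, and for $z\in\mathbb R^2$, $y\in\partial B$ and $M\in\{0,1,2,\dots\}$ define $$\varphi_{z}(y)=\varphi_{z,M}(y)=\sum_{n=0}^{M}\frac{4}{i|y|\pi(1+\delta_{0n})}\,\frac{J_n(k|z|)}{H^{(1)}_n(kr_o)}\cos(n\theta_{yz}),\qquad \varphi_{z,\infty}(y)=\sum_{n=0}^{\infty}\frac{4}{i|y|\pi(1+\delta_{0n})}\,\frac{J_n(k|z|)}{H^{(1)}_n(kr_o)}\cos(n\theta_{yz})$$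 (equivalently, $\varphi_z(y)=\sum_{n=-M}^{M}\frac{2}{i|y|\pi}\frac{J_n(k|z|)}{H^{(1)}_n(kr_o)}\cos(n\theta_{yz})$, and likewise for $\varphi_{z,\infty}$). Then $H_n^{(1)}(kr_o)\neq0$ for every $n\in\mathbb Z$, the series for $\varphi_{z,\infty}(y)$ converges absolutely, $\varphi_z,\varphi_{z,\infty}\in L^2(\partial B)$, and for all $z\in\mathbb R^2$ and $x\in\partial\Omega$ the integrals defining $\mathrm H\varphi_z(x)$ and $\mathrm H\varphi_{z,\infty}(x)$ converge absolutely, with $$(\mathrm H\varphi_z)(x)=\sum_{n=-M}^{M}J_n(k|x|)\,J_n(k|z|)\cos(n\theta_{xz})$$ and $$(\mathrm H\varphi_{z,\infty})(x)=\sum_{n=-\infty}^{\infty}J_n(k|x|)\,J_n(k|z|)\cos(n\theta_{xz})=J_0(k|x-z|),$$ the last series converging absolutely. Moreover, as $M\to\infty$, both $\mathrm H\varphi_{z,M}(x)\to\mathrm H\varphi_{z,\infty}(x)$ and $\sum_{n=-M}^{M}J_n(k|x|)J_n(k|z|)\cos(n\theta_{xz})\to J_0(k|x-z|)$ uniformly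 for $x\in\partial\Omega$ and $z$ in any bounded subset of $\mathbb R^2$. -/

import Mathlib

open MeasureTheory Filter Topology

/-- The Euclidean plane `ℝ²`. -/
abbrev Plane : Type := EuclideanSpace ℝ (Fin 2)

/-- The Bessel function `J_n` of order `n = 0, 1, 2, …`:
`J_n(t) = ∑_{p ≥ 0} (-1)^p / (p! (n+p)!) (t/2)^{n+2p}`. -/
noncomputable def besselJNat (n : ℕ) (t : ℝ) : ℝ :=
  ∑' p : ℕ, (-1 : ℝ) ^ p / ((p.factorial : ℝ) * ((n + p).factorial : ℝ)) * (t / 2) ^ (n + 2 * p)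

/-- The Neumann function (Bessel function of the second kind) `Y_n` of order `n = 0, 1, 2, …`
at `t > 0`:
`Y_n(t) = (2/π) (log (t/2) + γ) J_n(t) - (1/π) ∑_{p=0}^{n-1} (n-1-p)!/p! (2/t)^{n-2p}
  - (1/π) ∑_{p ≥ 0} (-1)^p / (p! (n+p)!) (t/2)^{n+2p} (h_{p+n} + h_p)`,
where `γ` is Euler's constant and `h_p = 1 + 1/2 + ⋯ + 1/p`, `h_0 = 0`. -/
noncomputable def besselYNat (n : ℕ) (t : ℝ) : ℝ :=
  2 / Real.pi * (Real.log (t / 2) + Real.eulerMascheroniConstant) * besselJNat n t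
    - 1 / Real.pi * ∑ p ∈ Finset.range n,
        ((n - 1 - p).factorial : ℝ) / (p.factorial : ℝ) * (2 / t) ^ ((n : ℤ) - 2 * (p : ℤ))
    - 1 / Real.pi * ∑' p : ℕ,
        (-1 : ℝ) ^ p / ((p.factorial : ℝ) * ((n + p).factorial : ℝ)) * (t / 2) ^ (n + 2 * p)
          * ((harmonic (p + n) : ℝ) + (harmonic p : ℝ))

/-- The sign relating orders `n` and `-n`: it is `1` for `n ≥ 0` and `(-1)^n` for `n < 0`. -/
def orderSign (n : ℤ) : ℝ := if n < 0 then (-1) ^ n.natAbs else 1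

/-- `J_n` for every integer order, with `J_{-n} = (-1)^n J_n`. -/
noncomputable def besselJ (n : ℤ) (t : ℝ) : ℝ := orderSign n * besselJNat n.natAbs t

/-- `Y_n` for every integer order, with `Y_{-n} = (-1)^n Y_n`. -/
noncomputable def besselY (n : ℤ) (t : ℝ) : ℝ := orderSign n * besselYNat n.natAbs t

/-- The Hankel function of the first kind `H_n^{(1)} = J_n + i Y_n`. -/
noncomputable def hankel1 (n : ℤ) (t : ℝ) : ℂ := (besselJ n t : ℂ) + Complex.I * (besselY n t : ℂ)

/-- The radiating fundamental solution `φ(x; y) = (i/4) H_0^{(1)}(k |x - y|)` of the Helmholtz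
equation in the plane. -/
noncomputable def fundSol (k : ℝ) (x y : Plane) : ℂ := Complex.I / 4 * hankel1 0 (k * ‖x - y‖)

/-- The point of the circle of radius `r` about the origin with polar angle `t`. -/
noncomputable def circlePoint (r t : ℝ) : Plane := !₂[r * Real.cos t, r * Real.sin t]

/-- Arc length `ds` on the circle `∂B = {|y| = r}`, as a measure on the plane: the image of `r dt`
on `(-π, π]` under `t ↦ r (cos t, sin t)`. -/
noncomputable def arcLength (r : ℝ) : Measure Plane :=
  ENNReal.ofReal r •
    Measure.map (circlePoint r) (volume.restrict (Set.Ioc (-Real.pi) Real.pi))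

/-- The operator `(H g)(x) = ∫_{∂B} φ(x; y) g(y) ds(y)`, with `∂B = {|y| = r}`. -/
noncomputable def opH (k r : ℝ) (g : Plane → ℂ) (x : Plane) : ℂ :=
  ∫ y, fundSol k x y * g y ∂(arcLength r)

/-- `cos (n θ_{xy})`, with `θ_{xy}` the angle between `x` and `y`. -/
noncomputable def cosAngle (n : ℤ) (x y : Plane) : ℝ :=
  Real.cos (n * InnerProductGeometry.angle x y)

/-- The `n`-th term `4 / (i |y| π (1 + δ_{0n})) · J_n(k|z|) / H_n^{(1)}(k|y|) · cos (n θ_{yz})` of the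
density, for `n = 0, 1, 2, …`. -/
noncomputable def densityTerm (k : ℝ) (z y : Plane) (n : ℕ) : ℂ :=
  4 / (Complex.I * (‖y‖ : ℂ) * (Real.pi : ℂ) * (1 + if n = 0 then 1 else 0))
    * ((besselJ n (k * ‖z‖) : ℂ) / hankel1 n (k * ‖y‖)) * (cosAngle n y z : ℂ)

/-- The density `φ_z` truncated at order `M`. -/
noncomputable def density (k : ℝ) (M : ℕ) (z y : Plane) : ℂ :=
  ∑ n ∈ Finset.range (M + 1), densityTerm k z y n

/-- The density `φ_{z,∞}`. -/
noncomputable def densityInf (k : ℝ) (z y : Plane) : ℂ := ∑' n : ℕ, densityTerm k z y n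

/-- `J_n(k|x|) J_n(k|z|) cos (n θ_{xz})`. -/
noncomputable def besselProduct (k : ℝ) (x z : Plane) (n : ℤ) : ℝ :=
  besselJ n (k * ‖x‖) * besselJ n (k * ‖z‖) * cosAngle n x z

/-! The heart of the matter is Graf's addition theorem: for `0 ≤ ρ < r` the `n`-th Fourier
coefficient of `t ↦ H_0(|r e^{it} - ρ|)` is `H_n(r) J_n(ρ)`. Pairing the fundamental solution with
`cos (n θ_{yz})` over the circle therefore yields `H_n(kr) J_n(k|x|) cos (n θ_{xz})` up to a
constant. The density carries `J_n(k|z|) / H_n(kr)`, so the Hankel factor cancels and one term of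
the Bessel sum is left.

Graf's theorem is proved by uniqueness for an infinite linear system (`eq_zero_of_recurrence`). The
waves `Z_m(|w|) e^{i m arg w}` at `w = r e^{it} - ρ` satisfy `W_m' = (W_{m+1} - W_{m-1}) / 2` in
`ρ`, hence so do their `n`-th Fourier coefficients. The functions `2π Z_n(r) J_{n-m}(ρ)` obey the
same system and agree with these coefficients at `ρ = 0`. At most factorial growth in `m` makes the
solution unique. The argument uses only the derivative and three-term recurrences and the growth
bound, so it covers `J` and `H` at once (`IsCylinderFamily`). These facts are derived from the power
series.

For `Z = J` the Fourier coefficients are summable, and the Fourier series gives Neumann's expansion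
of `J_0(k|x - z|)`; the case of equal radii follows by continuity.

Division by `H_n` is legitimate because the Wronskian `J_{n+1} Y_n - J_n Y_{n+1} = 2/(πt)` rules out
a common zero of `J_n` and `Y_n`. The sequence `1/H_n(kr)` is bounded because `|Y_n|` is eventually
at least 1, while `J_n(k|z|)` decays like `B^n / n!`. This gives absolute convergence of the density
and the exchange of sum and integral. Uniform convergence is the Weierstrass test for the Bessel
products. -/

/-! ### Power series with factorially decaying coefficients -/

section Series

variable {K : ℝ} {a : ℕ → ℝ} {n : ℕ}

lemma abs_coeff_mul_pow_le (ha : ∀ p, |a p| ≤ K / p.factorial) (t : ℝ) (p : ℕ) :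
    |a p * (t / 2) ^ (n + 2 * p)| ≤ K * |t / 2| ^ n * ((t ^ 2 / 4) ^ p / p.factorial) := by
  have h : |(t / 2) ^ (n + 2 * p)| = |t / 2| ^ n * (t ^ 2 / 4) ^ p := by
    rw [abs_pow, pow_add, pow_mul, sq_abs]; ring
  rw [abs_mul, h]
  calc |a p| * (|t / 2| ^ n * (t ^ 2 / 4) ^ p)
      ≤ K / p.factorial * (|t / 2| ^ n * (t ^ 2 / 4) ^ p) := by
        gcongr; exact ha p
    _ = _ := by ring

lemma hasSum_exp_majorant (K c x : ℝ) :
    HasSum (fun p : ℕ => K * c * (x ^ p / p.factorial)) (K * c * Real.exp x) := by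
  rw [Real.exp_eq_exp_ℝ]
  exact (NormedSpace.expSeries_div_hasSum_exp x).mul_left _

lemma summable_coeff_mul_pow (ha : ∀ p, |a p| ≤ K / p.factorial) (t : ℝ) :
    Summable (fun p => a p * (t / 2) ^ (n + 2 * p)) :=
  Summable.of_norm_bounded (hasSum_exp_majorant K (|t / 2| ^ n) _).summable
    (abs_coeff_mul_pow_le ha t)

lemma abs_tsum_coeff_mul_pow_le (ha : ∀ p, |a p| ≤ K / p.factorial) (t : ℝ) :
    |∑' p, a p * (t / 2) ^ (n + 2 * p)| ≤ K * |t / 2| ^ n * Real.exp (t ^ 2 / 4) := by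
  rw [← Real.norm_eq_abs]
  exact tsum_of_norm_bounded (hasSum_exp_majorant K (|t / 2| ^ n) (t ^ 2 / 4))
    (abs_coeff_mul_pow_le ha t)

lemma hasDerivAt_coeff_series (ha : ∀ p, |a p| ≤ K / p.factorial) (t : ℝ) :
    HasDerivAt (fun t => ∑' p, a p * (t / 2) ^ (n + 2 * p))
      (∑' p, a p * ((n + 2 * p : ℕ) * (t / 2) ^ (n + 2 * p - 1) * (1 / 2))) t := by
  have hK : 0 ≤ K := by simpa using (abs_nonneg _).trans (ha 0)
  -- The excess 2 makes `R / 2 ≥ 1`, so replacing the exponent `n + 2p - 1` by `n + 2p` only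
  -- enlarges the majorant, also where the subtraction truncates at `n = p = 0`.
  set R : ℝ := |t| + 2 with hR
  have hR2 : 1 ≤ R / 2 := by have := abs_nonneg t; linarith
  have hsum : Summable (fun p : ℕ => K * (R / 2) ^ n * ((2 ^ n * (R ^ 2)) ^ p / p.factorial)
      * 2 ^ n) := by
    exact (hasSum_exp_majorant K ((R / 2) ^ n) _).summable.mul_right _
  refine hasDerivAt_tsum_of_isPreconnected
    (g := fun (p : ℕ) (t : ℝ) => a p * (t / 2) ^ (n + 2 * p))
    (g' := fun (p : ℕ) (t : ℝ) =>
      a p * ((n + 2 * p : ℕ) * (t / 2) ^ (n + 2 * p - 1) * (1 / 2))) hsum Metric.isOpen_ball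
    (convex_ball (0 : ℝ) R).isPreconnected (fun p y _ => ?_) (fun p y hy => ?_)
    (y₀ := t) (by simp [hR]) (summable_coeff_mul_pow ha t) (by simp [hR])
  · have := ((hasDerivAt_id y).div_const 2).pow (n + 2 * p)
    exact this.const_mul (a p)
  · have hy' : |y / 2| ≤ R / 2 := by
      rw [abs_div, abs_two]; have : |y| < R := by simpa using hy
      linarith
    have h1 : ((n + 2 * p : ℕ) : ℝ) ≤ 2 ^ (n + 2 * p) := by
      exact_mod_cast (Nat.lt_two_pow_self).le
    have h2 : |y / 2| ^ (n + 2 * p - 1) ≤ (R / 2) ^ (n + 2 * p) :=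
      (pow_le_pow_left₀ (abs_nonneg _) hy' _).trans (pow_le_pow_right₀ hR2 (Nat.sub_le _ _))
    rw [Real.norm_eq_abs, abs_mul, abs_mul, abs_mul, abs_pow, Nat.abs_cast]
    calc |a p| * (((n + 2 * p : ℕ) : ℝ) * |y / 2| ^ (n + 2 * p - 1) * |1 / 2|)
        ≤ K / p.factorial * (2 ^ (n + 2 * p) * (R / 2) ^ (n + 2 * p) * 1) := by
          gcongr
          · exact ha p
          · norm_num [abs_of_pos]
      _ = K * (R / 2) ^ n * ((R ^ 2) ^ p / p.factorial) * 2 ^ n := by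
          simp only [pow_add, pow_mul, div_pow]; field_simp
      _ ≤ _ := by
          gcongr
          have : (1 : ℝ) ≤ 2 ^ n := one_le_pow₀ (by norm_num)
          nlinarith [sq_nonneg R]

lemma continuous_coeff_series (ha : ∀ p, |a p| ≤ K / p.factorial) :
    Continuous (fun t : ℝ => ∑' p, a p * (t / 2) ^ (n + 2 * p)) :=
  continuous_iff_continuousAt.2 fun t => (hasDerivAt_coeff_series ha t).continuousAt

/-- The Euler operator `t d/dt` preserves each power and multiplies it by its exponent. In this form
the Bessel recurrences reduce to identities between coefficients. -/
lemma hasDerivAt_coeff_series' (ha : ∀ p, |a p| ≤ K / p.factorial) (t : ℝ) :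
    ∃ f', HasDerivAt (fun t => ∑' p, a p * (t / 2) ^ (n + 2 * p)) f' t ∧
      HasSum (fun p => a p * (t / 2) ^ (n + 2 * p) * (n + 2 * p)) (t * f') := by
  refine ⟨_, hasDerivAt_coeff_series ha t, ?_⟩
  have key : ∀ p, a p * (t / 2) ^ (n + 2 * p) * (n + 2 * p) =
      t * (a p * ((n + 2 * p : ℕ) * (t / 2) ^ (n + 2 * p - 1) * (1 / 2))) := by
    intro p
    rcases Nat.eq_zero_or_pos (n + 2 * p) with h | h
    · have h1 : n = 0 := by omega
      have h2 : p = 0 := by omega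
      simp [h1, h2]
    · obtain ⟨q, hq⟩ : ∃ q, n + 2 * p = q + 1 := ⟨n + 2 * p - 1, by omega⟩
      have : (n : ℝ) + 2 * p = q + 1 := by exact_mod_cast hq
      rw [hq, Nat.add_sub_cancel, this, pow_succ]; push_cast; ring
  have hs : Summable (fun p => a p * (t / 2) ^ (n + 2 * p) * (n + 2 * p)) := by
    have h4 : Summable (fun p : ℕ => K * |t / 2| ^ n * ((2 * 2 * (t ^ 2 / 4)) ^ p / p.factorial)
      * 2 ^ n) := (hasSum_exp_majorant K (|t / 2| ^ n) _).summable.mul_right _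
    refine Summable.of_norm_bounded h4 fun p => ?_
    have h1 : ((n + 2 * p : ℕ) : ℝ) ≤ 2 ^ (n + 2 * p) := by
      exact_mod_cast (Nat.lt_two_pow_self).le
    have h0 : (n : ℝ) + 2 * p = ((n + 2 * p : ℕ) : ℝ) := by push_cast; rfl
    rw [Real.norm_eq_abs, abs_mul, h0, Nat.abs_cast]
    calc _ ≤ K * |t / 2| ^ n * ((t ^ 2 / 4) ^ p / p.factorial) * 2 ^ (n + 2 * p) := by
          gcongr
          · exact (abs_nonneg _).trans (abs_coeff_mul_pow_le ha t p)
          · exact abs_coeff_mul_pow_le ha t p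
      _ = _ := by rw [pow_add, pow_mul, mul_pow]; norm_num; ring
  have := hs.hasSum
  convert this using 1
  rw [← tsum_mul_left]
  exact tsum_congr fun p => (key p).symm

end Series

/-! ### Coefficients of the Bessel and Neumann series -/

/-- The coefficient `(-1)^p / (p! (n+p)!)` of the Bessel series. -/
noncomputable def besselCoeff (n p : ℕ) : ℝ :=
  (-1 : ℝ) ^ p / ((p.factorial : ℝ) * ((n + p).factorial : ℝ))

/-- The harmonic weight `h_{p+n} + h_p` in the Neumann series. -/
noncomputable def harmonicWeight (n p : ℕ) : ℝ := (harmonic (p + n) : ℝ) + (harmonic p : ℝ)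

/-- The last series in the definition of `Y_n`, without the factor `-1/π`. -/
noncomputable def neumannSeries (n : ℕ) (t : ℝ) : ℝ :=
  ∑' p : ℕ, besselCoeff n p * harmonicWeight n p * (t / 2) ^ (n + 2 * p)

/-- The finite sum in the definition of `Y_n`, without the factor `-1/π`. -/
noncomputable def neumannPolar (n : ℕ) (t : ℝ) : ℝ :=
  ∑ p ∈ Finset.range n,
    ((n - 1 - p).factorial : ℝ) / (p.factorial : ℝ) * (2 / t) ^ ((n : ℤ) - 2 * (p : ℤ))

lemma besselJNat_eq (n : ℕ) :
    besselJNat n = fun t => ∑' p, besselCoeff n p * (t / 2) ^ (n + 2 * p) := rfl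

lemma besselYNat_eq (n : ℕ) (t : ℝ) :
    besselYNat n t = 2 / Real.pi * (Real.log (t / 2) + Real.eulerMascheroniConstant)
      * besselJNat n t - 1 / Real.pi * neumannPolar n t - 1 / Real.pi * neumannSeries n t := by
  unfold besselYNat neumannPolar neumannSeries
  congr 2
  refine tsum_congr fun p => ?_
  rw [harmonicWeight, besselCoeff]; ring

lemma besselCoeff_succ_right (n p : ℕ) :
    besselCoeff n (p + 1) * (p + 1) = -besselCoeff (n + 1) p := by
  unfold besselCoeff
  rw [show n + (p + 1) = n + 1 + p by ring, Nat.factorial_succ p, pow_succ]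
  have : (p : ℝ) + 1 ≠ 0 := by positivity
  push_cast; field_simp

lemma besselCoeff_succ_left (n p : ℕ) :
    besselCoeff (n + 1) p * (n + 1 + p) = besselCoeff n p := by
  unfold besselCoeff
  rw [show n + 1 + p = n + p + 1 by ring, Nat.factorial_succ (n + p)]
  have : (n : ℝ) + p + 1 ≠ 0 := by positivity
  have : (n : ℝ) + 1 + p ≠ 0 := by positivity
  push_cast; field_simp; ring

lemma abs_besselCoeff (n p : ℕ) :
    |besselCoeff n p| = 1 / ((p.factorial : ℝ) * ((n + p).factorial : ℝ)) := by
  rw [besselCoeff, abs_div, abs_pow, abs_neg, abs_one, one_pow, abs_of_pos (by positivity)]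

lemma abs_besselCoeff_le (n p : ℕ) :
    |besselCoeff n p| ≤ (1 / (n.factorial : ℝ)) / p.factorial := by
  rw [abs_besselCoeff, div_div, mul_comm]
  gcongr
  exact Nat.le_add_right n p

lemma harmonicWeight_nonneg (n p : ℕ) : 0 ≤ harmonicWeight n p := by
  have (m : ℕ) : (0 : ℝ) ≤ (harmonic m : ℝ) := by
    exact_mod_cast Finset.sum_nonneg fun i _ => by positivity
  exact add_nonneg (this _) (this _)

lemma harmonicWeight_le (n p : ℕ) : harmonicWeight n p ≤ 2 * (n + p : ℕ) := by
  have (m : ℕ) : (harmonic m : ℝ) ≤ m := by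
    have : harmonic m ≤ m := by
      unfold harmonic
      refine (Finset.sum_le_card_nsmul _ _ 1 fun i _ => ?_).trans (by simp)
      exact inv_le_one_of_one_le₀ (by norm_cast; omega)
    exact_mod_cast this
  have h1 := this (p + n)
  have h2 := this p
  unfold harmonicWeight
  push_cast at *
  have : (0 : ℝ) ≤ n := by positivity
  linarith

lemma abs_neumannCoeff_le (n p : ℕ) :
    |besselCoeff n p * harmonicWeight n p| ≤ 2 / p.factorial := by
  rw [abs_mul, abs_besselCoeff, abs_of_nonneg (harmonicWeight_nonneg n p)]
  have h1 := harmonicWeight_le n p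
  have h2 : ((n + p : ℕ) : ℝ) ≤ (n + p).factorial := by exact_mod_cast Nat.self_le_factorial _
  calc _ ≤ 1 / ((p.factorial : ℝ) * ((n + p).factorial : ℝ)) * (2 * (n + p).factorial) := by
        gcongr; linarith
    _ = _ := by field_simp

lemma abs_besselJNat_le (n : ℕ) (t : ℝ) :
    |besselJNat n t| ≤ 1 / (n.factorial : ℝ) * |t / 2| ^ n * Real.exp (t ^ 2 / 4) :=
  abs_tsum_coeff_mul_pow_le (abs_besselCoeff_le n) t

lemma abs_neumannSeries_le (n : ℕ) (t : ℝ) :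
    |neumannSeries n t| ≤ 2 * |t / 2| ^ n * Real.exp (t ^ 2 / 4) :=
  abs_tsum_coeff_mul_pow_le (abs_neumannCoeff_le n) t

lemma continuous_besselJNat (n : ℕ) : Continuous (besselJNat n) :=
  continuous_coeff_series (abs_besselCoeff_le n)

lemma continuous_neumannSeries (n : ℕ) : Continuous (neumannSeries n) :=
  continuous_coeff_series (abs_neumannCoeff_le n)

lemma hasSum_besselJNat (n : ℕ) (t : ℝ) :
    HasSum (fun p => besselCoeff n p * (t / 2) ^ (n + 2 * p)) (besselJNat n t) :=
  (summable_coeff_mul_pow (abs_besselCoeff_le n) t).hasSum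

lemma hasSum_neumannSeries (n : ℕ) (t : ℝ) :
    HasSum (fun p => besselCoeff n p * harmonicWeight n p * (t / 2) ^ (n + 2 * p))
      (neumannSeries n t) :=
  (summable_coeff_mul_pow (abs_neumannCoeff_le n) t).hasSum

lemma harmonicWeight_succ_right (n p : ℕ) :
    harmonicWeight n (p + 1) = harmonicWeight (n + 1) p + 1 / (p + 1) := by
  unfold harmonicWeight
  rw [show p + 1 + n = p + (n + 1) by ring, harmonic_succ p]
  push_cast; simp; ring

lemma harmonicWeight_succ_left (n p : ℕ) :
    harmonicWeight (n + 1) p = harmonicWeight n p + 1 / (n + 1 + p) := by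
  unfold harmonicWeight
  rw [show p + (n + 1) = p + n + 1 by ring, harmonic_succ (p + n)]
  push_cast; rw [one_div, show (n : ℝ) + 1 + p = p + n + 1 by ring]; ring

/-! ### Derivative recurrences from the series -/

/-- `J_n' = (n/t) J_n - J_{n+1}`. -/
lemma hasDerivAt_besselJNat (n : ℕ) {t : ℝ} (ht : t ≠ 0) :
    HasDerivAt (besselJNat n) (n / t * besselJNat n t - besselJNat (n + 1) t) t := by
  obtain ⟨f', hf, hs⟩ := hasDerivAt_coeff_series' (abs_besselCoeff_le n) t (n := n)
  have h1 := hs.sub ((hasSum_besselJNat n t).mul_right (n : ℝ))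
  have h2 := (hasSum_nat_add_iff' 1).2 h1
  have h3 := (hasSum_besselJNat (n + 1) t).mul_right (-t)
  have h4 := h3.unique (h2.congr_fun fun p => ?_)
  · rw [besselJNat_eq n]
    convert hf using 1
    simp at h4
    rw [← besselJNat_eq]
    field_simp
    linarith
  · have := besselCoeff_succ_right n p
    rw [show n + 2 * (p + 1) = n + 1 + 2 * p + 1 by ring, pow_succ]
    push_cast
    linear_combination (-t) * (t / 2) ^ (n + 1 + 2 * p) * this

/-- `J_{n+1}' = J_n - ((n+1)/t) J_{n+1}`. -/
lemma hasDerivAt_besselJNat_succ (n : ℕ) {t : ℝ} (ht : t ≠ 0) :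
    HasDerivAt (besselJNat (n + 1))
      (besselJNat n t - (n + 1) / t * besselJNat (n + 1) t) t := by
  obtain ⟨f', hf, hs⟩ := hasDerivAt_coeff_series' (abs_besselCoeff_le (n + 1)) t (n := n + 1)
  have h1 := hs.add ((hasSum_besselJNat (n + 1) t).mul_right ((n : ℝ) + 1))
  have h3 := (hasSum_besselJNat n t).mul_right t
  have h4 := h3.unique (h1.congr_fun fun p => ?_)
  · rw [besselJNat_eq (n + 1)]
    convert hf using 1
    rw [← besselJNat_eq]
    field_simp
    linarith
  · have := besselCoeff_succ_left n p
    rw [show n + 1 + 2 * p = n + 2 * p + 1 by ring, pow_succ]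
    push_cast
    linear_combination (-t) * (t / 2) ^ (n + 2 * p) * this

/-- The harmonic weights make the recurrence of `J_n` fail by a multiple of `J_n` without its `p =
0` term. In `Y_n` the derivative of the logarithm cancels the `J_n` part, and the defect of the
polar sum restores the missing term. -/
lemma hasDerivAt_neumannSeries (n : ℕ) (t : ℝ) :
    ∃ s', HasDerivAt (neumannSeries n) s' t ∧
      t * s' - n * neumannSeries n t + t * neumannSeries (n + 1) t =
        2 * (besselJNat n t - (t / 2) ^ n / n.factorial) := by
  obtain ⟨f', hf, hs⟩ := hasDerivAt_coeff_series' (abs_neumannCoeff_le n) t (n := n)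
  refine ⟨f', hf, ?_⟩
  have h1 := (hasSum_nat_add_iff' 1).2 (hs.sub ((hasSum_neumannSeries n t).mul_right (n : ℝ)))
  have h2 := h1.add ((hasSum_neumannSeries (n + 1) t).mul_right t)
  have h3 := ((hasSum_nat_add_iff' 1).2 (hasSum_besselJNat n t)).mul_right 2
  have h4 := h3.unique (h2.congr_fun fun p => ?_)
  · simp [besselCoeff] at h4
    linear_combination -h4
  · have e1 := besselCoeff_succ_right n p
    have e2 := harmonicWeight_succ_right n p
    have hp : (p : ℝ) + 1 ≠ 0 := by positivity
    have e3 : harmonicWeight (n + 1) p * (p + 1) = harmonicWeight n (p + 1) * (p + 1) - 1 := by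
      rw [e2]; field_simp; ring
    rw [show n + 2 * (p + 1) = n + 1 + 2 * p + 1 by ring, pow_succ]
    push_cast
    have e4 : besselCoeff (n + 1) p = -(besselCoeff n (p + 1) * (p + 1)) := by linarith
    rw [e4]
    linear_combination t * (t / 2) ^ (n + 1 + 2 * p) * besselCoeff n (p + 1) * e3

lemma hasDerivAt_neumannSeries_succ (n : ℕ) (t : ℝ) :
    ∃ s', HasDerivAt (neumannSeries (n + 1)) s' t ∧
      t * s' + (n + 1) * neumannSeries (n + 1) t - t * neumannSeries n t =
        2 * besselJNat (n + 1) t := by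
  obtain ⟨f', hf, hs⟩ := hasDerivAt_coeff_series' (abs_neumannCoeff_le (n + 1)) t (n := n + 1)
  refine ⟨f', hf, ?_⟩
  have h1 := (hs.add ((hasSum_neumannSeries (n + 1) t).mul_right ((n : ℝ) + 1))).sub
    ((hasSum_neumannSeries n t).mul_right t)
  have h3 := (hasSum_besselJNat (n + 1) t).mul_right 2
  have h4 := h3.unique (h1.congr_fun fun p => ?_)
  · linear_combination -h4
  · have e1 := besselCoeff_succ_left n p
    have e2 := harmonicWeight_succ_left n p
    have hp : (n : ℝ) + 1 + p ≠ 0 := by positivity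
    have e3 : harmonicWeight (n + 1) p * (n + 1 + p) = harmonicWeight n p * (n + 1 + p) + 1 := by
      rw [e2]; field_simp
    rw [show n + 1 + 2 * p = n + 2 * p + 1 by ring, pow_succ, ← e1]
    push_cast
    linear_combination (-t) * (t / 2) ^ (n + 2 * p) * besselCoeff (n + 1) p * e3

lemma hasDerivAt_two_div_zpow (m : ℤ) {t : ℝ} (ht : t ≠ 0) :
    HasDerivAt (fun t : ℝ => (2 / t) ^ m) (-m / t * (2 / t) ^ m) t := by
  have h2 : (2 / t) ≠ 0 := div_ne_zero two_ne_zero ht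
  refine ((hasDerivAt_zpow m (2 / t) (Or.inl h2)).comp t
    ((hasDerivAt_inv ht).const_mul (2 : ℝ))).congr_deriv ?_
  rw [zpow_sub_one₀ h2]
  field_simp

lemma hasDerivAt_neumannPolar_aux (n : ℕ) {t : ℝ} (ht : t ≠ 0) :
    HasDerivAt (neumannPolar n) (∑ p ∈ Finset.range n,
      ((n - 1 - p).factorial : ℝ) / (p.factorial : ℝ) *
        (-(((n : ℤ) - 2 * (p : ℤ) : ℤ) : ℝ) / t * (2 / t) ^ ((n : ℤ) - 2 * (p : ℤ)))) t := by
  exact HasDerivAt.fun_sum (u := Finset.range n) (x := t) fun p _ =>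
    (hasDerivAt_two_div_zpow ((n : ℤ) - 2 * (p : ℤ)) ht).const_mul
      (((n - 1 - p).factorial : ℝ) / (p.factorial : ℝ))

lemma hasDerivAt_neumannPolar (n : ℕ) {t : ℝ} (ht : t ≠ 0) :
    ∃ s', HasDerivAt (neumannPolar n) s' t ∧
      t * s' - n * neumannPolar n t + t * neumannPolar (n + 1) t =
        2 * ((t / 2) ^ n / n.factorial) := by
  refine ⟨_, hasDerivAt_neumannPolar_aux n ht, ?_⟩
  have h2 : (2 / t) ≠ 0 := div_ne_zero two_ne_zero ht
  -- Passing from `n` to `n + 1` adds the summand `p = n`, which alone produces the right-hand side;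
  -- the other summands cancel for each `p`.
  have hlast : t * ((n.factorial : ℝ)⁻¹ * (2 / t) ^ ((n + 1 : ℕ) - 2 * (n : ℤ) : ℤ)) =
      2 * ((t / 2) ^ n / n.factorial) := by
    have : ((n + 1 : ℕ) - 2 * (n : ℤ) : ℤ) = 1 - n := by push_cast; ring
    rw [this, zpow_sub₀ h2, zpow_one, zpow_natCast, div_pow, div_pow]
    field_simp
  unfold neumannPolar
  rw [Finset.sum_range_succ (n := n), mul_add]
  simp only [Nat.add_sub_cancel, Nat.sub_self, Nat.factorial_zero, Nat.cast_one, one_div]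
  rw [hlast, ← add_assoc, add_eq_right, Finset.mul_sum, Finset.mul_sum, Finset.mul_sum,
    ← Finset.sum_sub_distrib, ← Finset.sum_add_distrib]
  refine Finset.sum_eq_zero fun p hp => ?_
  have hp' : p < n := Finset.mem_range.1 hp
  obtain ⟨q, rfl⟩ : ∃ q, n = p + 1 + q := ⟨n - (p + 1), by omega⟩
  rw [show p + 1 + q - 1 - p = q by omega, show p + 1 + q - p = q + 1 by omega,
    Nat.factorial_succ,
    show ((p + 1 + q + 1 : ℕ) : ℤ) - 2 * (p : ℤ) = ((p + 1 + q : ℕ) - 2 * (p : ℤ)) + 1 by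
      push_cast; ring, zpow_add_one₀ h2]
  push_cast
  field_simp
  ring

lemma hasDerivAt_neumannPolar_succ (n : ℕ) {t : ℝ} (ht : t ≠ 0) :
    ∃ s', HasDerivAt (neumannPolar (n + 1)) s' t ∧
      t * s' + (n + 1) * neumannPolar (n + 1) t - t * neumannPolar n t = 0 := by
  refine ⟨_, hasDerivAt_neumannPolar_aux (n + 1) ht, ?_⟩
  have h2 : (2 / t) ≠ 0 := div_ne_zero two_ne_zero ht
  unfold neumannPolar
  rw [Finset.mul_sum, Finset.mul_sum, ← Finset.sum_add_distrib, Finset.sum_range_succ',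
    Finset.mul_sum, add_sub_right_comm, ← Finset.sum_sub_distrib]
  -- The index is shifted by one: the `p = 0` summand is annihilated by `t d/dt + (n + 1)`, and the
  -- summand `p + 1` cancels against the summand `p` of order `n`.
  have h0 : ∀ x : ℝ, x = 0 → ∀ y : ℝ, y = 0 → x + y = 0 := by rintro _ rfl _ rfl; simp
  apply h0
  · refine Finset.sum_eq_zero fun p hp => ?_
    have hp' : p < n := Finset.mem_range.1 hp
    obtain ⟨q, rfl⟩ : ∃ q, n = p + 1 + q := ⟨n - (p + 1), by omega⟩
    rw [show p + 1 + q - 1 - p = q by omega, show p + 1 + q + 1 - 1 - (p + 1) = q by omega,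
      Nat.factorial_succ p,
      show ((p + 1 + q : ℕ) : ℤ) - 2 * (p : ℤ)
        = (((p + 1 + q + 1 : ℕ) : ℤ) - 2 * ((p + 1 : ℕ) : ℤ)) + 1 by push_cast; ring,
      zpow_add_one₀ h2]
    have : (p : ℝ) + 1 ≠ 0 := by positivity
    push_cast
    field_simp
    ring
  · push_cast
    field_simp
    ring

lemma hasDerivAt_log_half {t : ℝ} (ht : t ≠ 0) :
    HasDerivAt (fun t : ℝ => Real.log (t / 2)) (1 / t) t := by
  refine (((hasDerivAt_id' t).div_const 2).log (by simpa using ht)).congr_deriv ?_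
  field_simp

/-- `Y_n' = (n/t) Y_n - Y_{n+1}`. -/
lemma hasDerivAt_besselYNat (n : ℕ) {t : ℝ} (ht : t ≠ 0) :
    HasDerivAt (besselYNat n) (n / t * besselYNat n t - besselYNat (n + 1) t) t := by
  obtain ⟨s', hs, es⟩ := hasDerivAt_neumannSeries n t
  obtain ⟨p', hp, ep⟩ := hasDerivAt_neumannPolar n ht
  have hl := hasDerivAt_log_half ht
  have h := ((((hl.add_const Real.eulerMascheroniConstant).const_mul (2 / Real.pi)).mul
    (hasDerivAt_besselJNat n ht)).sub (hp.const_mul (1 / Real.pi))).sub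
      (hs.const_mul (1 / Real.pi))
  rw [show besselYNat n = _ from funext (besselYNat_eq n)]
  refine h.congr_deriv ?_
  rw [besselYNat_eq]
  have hpi := Real.pi_ne_zero
  field_simp
  linear_combination -es - ep

/-- `Y_{n+1}' = Y_n - ((n+1)/t) Y_{n+1}`. -/
lemma hasDerivAt_besselYNat_succ (n : ℕ) {t : ℝ} (ht : t ≠ 0) :
    HasDerivAt (besselYNat (n + 1))
      (besselYNat n t - (n + 1) / t * besselYNat (n + 1) t) t := by
  obtain ⟨s', hs, es⟩ := hasDerivAt_neumannSeries_succ n t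
  obtain ⟨p', hp, ep⟩ := hasDerivAt_neumannPolar_succ n ht
  have hl := hasDerivAt_log_half ht
  have h := ((((hl.add_const Real.eulerMascheroniConstant).const_mul (2 / Real.pi)).mul
    (hasDerivAt_besselJNat_succ n ht)).sub (hp.const_mul (1 / Real.pi))).sub
      (hs.const_mul (1 / Real.pi))
  rw [show besselYNat (n + 1) = _ from funext (besselYNat_eq (n + 1))]
  refine h.congr_deriv ?_
  rw [besselYNat_eq]
  have hpi := Real.pi_ne_zero
  field_simp
  linear_combination -es - ep

/-! ### Growth of `Y_n` in the order -/

lemma neumannPolar_nonneg (n : ℕ) {t : ℝ} (ht : 0 < t) : 0 ≤ neumannPolar n t :=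
  Finset.sum_nonneg fun _ _ => by positivity

/-- Since `(2/t)^{n-2p} = (2/t)^n (t²/4)^p`, the sum is dominated by a partial sum of the
exponential series. -/
lemma neumannPolar_le (n : ℕ) {t : ℝ} (ht : 0 < t) :
    neumannPolar n t ≤ n.factorial * (2 / t) ^ n * Real.exp (t ^ 2 / 4) := by
  calc neumannPolar n t
      ≤ ∑ p ∈ Finset.range n, n.factorial * (2 / t) ^ n * ((t ^ 2 / 4) ^ p / p.factorial) := by
        refine Finset.sum_le_sum fun p _ => ?_
        have h2 : (2 / t) ≠ 0 := by positivity
        have e : (2 / t) ^ ((n : ℤ) - 2 * (p : ℤ)) = (2 / t) ^ n * (t ^ 2 / 4) ^ p := by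
          rw [zpow_sub₀ h2, zpow_mul, zpow_natCast, zpow_natCast, div_eq_mul_inv, ← inv_pow]
          congr 2
          have : (2 / t) ^ (2 : ℤ) = (2 / t) ^ 2 := by norm_cast
          rw [this, div_pow, inv_div]; norm_num
        rw [e]
        have : (n - 1 - p).factorial ≤ n.factorial := Nat.factorial_le (by omega)
        calc ((n - 1 - p).factorial : ℝ) / p.factorial * ((2 / t) ^ n * (t ^ 2 / 4) ^ p)
            ≤ (n.factorial : ℝ) / p.factorial * ((2 / t) ^ n * (t ^ 2 / 4) ^ p) := by gcongr
          _ = _ := by ring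
    _ ≤ _ := by
        rw [← Finset.mul_sum]
        gcongr
        exact Real.sum_le_exp_of_nonneg (by positivity) n

lemma le_neumannPolar_succ (n : ℕ) {t : ℝ} (ht : 0 < t) :
    n.factorial * (2 / t) ^ (n + 1) ≤ neumannPolar (n + 1) t := by
  have := Finset.single_le_sum (s := Finset.range (n + 1)) (f := fun p =>
    ((n + 1 - 1 - p).factorial : ℝ) / (p.factorial : ℝ)
      * (2 / t) ^ (((n + 1 : ℕ) : ℤ) - 2 * (p : ℤ)))
    (fun _ _ => by positivity) (Finset.mem_range.2 (Nat.succ_pos n))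
  refine le_trans (le_of_eq ?_) this
  have e : (((n + 1 : ℕ) : ℤ) - 2 * ((0 : ℕ) : ℤ)) = ((n + 1 : ℕ) : ℤ) := by simp
  simp only [e, zpow_natCast]
  simp

lemma abs_log_half_le {A t : ℝ} (ht : 0 < t) (h1 : t / 2 ≤ A) (h2 : 2 / t ≤ A) :
    |Real.log (t / 2)| ≤ A := by
  have a1 := Real.log_le_sub_one_of_pos (half_pos ht)
  have a2 := Real.log_le_sub_one_of_pos (inv_pos.2 (half_pos ht))
  rw [Real.log_inv, inv_div] at a2
  exact abs_le.2 ⟨by linarith, by linarith⟩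

lemma abs_besselYNat_le {ε R : ℝ} (hε : 0 < ε) :
    ∃ C A : ℝ, 0 ≤ C ∧ 1 ≤ A ∧ ∀ (n : ℕ) (t : ℝ), ε ≤ t → t ≤ R →
      |besselYNat n t| ≤ C * A ^ n * n.factorial := by
  -- On `[ε, R]` this dominates `t/2` and `2/t`, hence also `|log (t/2)|`, because `log x ≤ x - 1`.
  set A : ℝ := max 1 (max (R / 2) (2 / ε)) with hA
  set E : ℝ := Real.exp (R ^ 2 / 4) with hE
  have hE0 : 0 < E := Real.exp_pos _
  have hA1 : 1 ≤ A := le_max_left _ _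
  have hpi := Real.pi_pos
  refine ⟨2 / Real.pi * (A + |Real.eulerMascheroniConstant|) * E + 1 / Real.pi * E
    + 1 / Real.pi * (2 * E), A, by positivity, hA1, fun n t h1 h2 => ?_⟩
  have ht : 0 < t := hε.trans_le h1
  have ht2 : |t / 2| ≤ A := by
    rw [abs_of_pos (by positivity)]
    exact (by linarith : t / 2 ≤ R / 2).trans ((le_max_left _ _).trans (le_max_right _ _))
  have ht3 : 2 / t ≤ A :=
    (by gcongr : 2 / t ≤ 2 / ε).trans ((le_max_right _ _).trans (le_max_right _ _))
  have hEt : Real.exp (t ^ 2 / 4) ≤ E := by rw [hE]; gcongr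
  have hf : (1 : ℝ) ≤ n.factorial := by exact_mod_cast n.factorial_pos
  have bJ : |besselJNat n t| ≤ A ^ n * n.factorial * E := by
    refine (abs_besselJNat_le n t).trans ?_
    have : 1 / (n.factorial : ℝ) ≤ n.factorial := by
      rw [div_le_iff₀ (by positivity)]; nlinarith
    calc _ ≤ n.factorial * A ^ n * E := by gcongr
      _ = _ := by ring
  have bS : |neumannSeries n t| ≤ A ^ n * n.factorial * (2 * E) := by
    refine (abs_neumannSeries_le n t).trans ?_
    calc _ ≤ 2 * A ^ n * E * 1 := by rw [mul_one]; gcongr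
      _ ≤ 2 * A ^ n * E * n.factorial := by gcongr
      _ = _ := by ring
  have bP : |neumannPolar n t| ≤ A ^ n * n.factorial * E := by
    rw [abs_of_nonneg (neumannPolar_nonneg n ht)]
    refine (neumannPolar_le n ht).trans ?_
    calc _ ≤ n.factorial * A ^ n * E := by gcongr
      _ = _ := by ring
  have bL : |Real.log (t / 2) + Real.eulerMascheroniConstant| ≤
      A + |Real.eulerMascheroniConstant| :=
    (abs_add_le _ _).trans (by
      gcongr; exact abs_log_half_le ht ((le_abs_self _).trans ht2) ht3)
  rw [besselYNat_eq]
  calc _ ≤ |2 / Real.pi * (Real.log (t / 2) + Real.eulerMascheroniConstant) * besselJNat n t|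
        + |1 / Real.pi * neumannPolar n t| + |1 / Real.pi * neumannSeries n t| := by
        refine (abs_sub _ _).trans ?_
        gcongr
        exact abs_sub _ _
    _ ≤ 2 / Real.pi * (A + |Real.eulerMascheroniConstant|) * (A ^ n * n.factorial * E)
        + 1 / Real.pi * (A ^ n * n.factorial * E)
        + 1 / Real.pi * (A ^ n * n.factorial * (2 * E)) := by
        simp only [abs_mul, abs_div, abs_of_pos hpi, abs_one, abs_two]
        gcongr
    _ = _ := by ring

/-- The first polar term `(n-1)! (2/t)^n` outgrows the logarithmic and series parts, which are of
size at most a constant times `(t/2)^n`. The bound 1 is all that is needed to keep `1/H_n` bounded.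
-/
lemma eventually_one_le_abs_besselYNat {t : ℝ} (ht : 0 < t) :
    ∀ᶠ n : ℕ in atTop, 1 ≤ |besselYNat n t| := by
  set s := t / 2 with hs
  have hs0 : 0 < s := half_pos ht
  have hpi := Real.pi_pos
  set A := max 1 s with hA
  have hA1 : 1 ≤ A := le_max_left _ _
  set L := |Real.log s + Real.eulerMascheroniConstant|
  set E := Real.exp (t ^ 2 / 4) with hE
  -- `K s^n` bounds the logarithmic and series parts of `π Y_n`. A polar sum of at least `K s^n + π`
  -- then forces `π Y_n ≤ -π`.
  set K : ℝ := 2 * L * E + 2 * E with hK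
  have hL : 0 ≤ L := abs_nonneg _
  have hE0 : 0 < E := Real.exp_pos _
  have hK0 : 0 ≤ K := by positivity
  have hlim : Tendsto (fun m : ℕ => (K + Real.pi) * A ^ 2 * ((A ^ 2) ^ m / m.factorial)) atTop
      (𝓝 ((K + Real.pi) * A ^ 2 * 0)) :=
    (FloorSemiring.tendsto_pow_div_factorial_atTop (A ^ 2)).const_mul _
  rw [mul_zero] at hlim
  rw [← map_add_atTop_eq_nat 1, eventually_map]
  filter_upwards [hlim.eventually_le_const one_pos] with m hm
  set n := m + 1 with hn
  have hfac : (0 : ℝ) < m.factorial := by positivity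
  have h1 : (K + Real.pi) * A ^ (2 * n) ≤ m.factorial := by
    have : (K + Real.pi) * A ^ (2 * n) =
        (K + Real.pi) * A ^ 2 * ((A ^ 2) ^ m / m.factorial) * m.factorial := by
      rw [hn, pow_mul, pow_succ]; field_simp
    rw [this]
    nlinarith
  have hsA : s ^ n ≤ A ^ n := pow_le_pow_left₀ hs0.le (le_max_right _ _) n
  have hAn : 1 ≤ A ^ n := one_le_pow₀ hA1
  have h2 : K * s ^ n + Real.pi ≤ neumannPolar n t := by
    refine le_trans ?_ (le_neumannPolar_succ m ht)
    have e : (2 / t) ^ (m + 1) = (s ^ n)⁻¹ := by rw [hn, hs, ← inv_pow, inv_div]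
    rw [e, ← div_eq_mul_inv, le_div_iff₀ (by positivity)]
    refine le_trans ?_ h1
    have : A ^ (2 * n) = A ^ n * A ^ n := by rw [← pow_add]; congr 1; ring
    rw [this]
    have hsn : 0 < s ^ n := by positivity
    have b1 : s ^ n * s ^ n ≤ A ^ n * A ^ n := by gcongr
    have b2 : s ^ n * 1 ≤ A ^ n * A ^ n := by gcongr
    nlinarith
  have bJ : |besselJNat n t| ≤ s ^ n * E := by
    refine (abs_besselJNat_le n t).trans ?_
    rw [← hs, abs_of_pos hs0]
    have : 1 / (n.factorial : ℝ) ≤ 1 := by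
      rw [div_le_iff₀ (by positivity)]
      have : (1 : ℝ) ≤ n.factorial := by exact_mod_cast n.factorial_pos
      linarith
    calc _ ≤ 1 * s ^ n * E := by gcongr
      _ = _ := by ring
  have bS : |neumannSeries n t| ≤ 2 * s ^ n * E := by
    simpa [← hs, abs_of_pos hs0] using abs_neumannSeries_le n t
  have key : Real.pi * besselYNat n t = 2 * ((Real.log s + Real.eulerMascheroniConstant)
      * besselJNat n t) - neumannPolar n t - neumannSeries n t := by
    rw [besselYNat_eq, ← hs]; field_simp
  have bLJ : |(Real.log s + Real.eulerMascheroniConstant) * besselJNat n t| ≤ L * (s ^ n * E) := by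
    rw [abs_mul]; gcongr
  have h3 : Real.pi * besselYNat n t ≤ -Real.pi := by
    rw [key]
    have := (abs_le.1 bLJ).2
    have := (abs_le.1 bS).1
    rw [hK] at h2
    linarith
  have h4 : besselYNat n t ≤ -1 := by
    by_contra hcon
    push Not at hcon
    nlinarith
  rw [abs_of_neg (by linarith)]
  linarith

/-! ### The Wronskian of order zero -/

lemma besselJNat_zero_zero : besselJNat 0 0 = 1 := by
  refine (hasSum_besselJNat 0 0).unique ?_
  convert hasSum_ite_eq 0 (1 : ℝ) using 2 with p
  rcases p with _ | p <;> simp [besselCoeff]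

/-- The function `t (J_1 Y_0 - J_0 Y_1)` is constant. -/
lemma bessel_wronskian_zero {t : ℝ} (ht : t ≠ 0) :
    t * (besselJNat 1 t * besselYNat 0 t - besselJNat 0 t * besselYNat 1 t) = 2 / Real.pi := by
  have hpi := Real.pi_ne_zero
  -- The logarithms cancel in the cross product, and the only polar term `2/t` is multiplied by `t`.
  -- The resulting formula is continuous at 0, where the constant can be read off as `2/π`.
  set G : ℝ → ℝ := fun t => (besselJNat 0 t * (2 + t * neumannSeries 1 t)
    - t * besselJNat 1 t * neumannSeries 0 t) / Real.pi with hG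
  have hGc : Continuous G := by
    have h1 := continuous_besselJNat 0
    have h2 := continuous_besselJNat 1
    have h3 := continuous_neumannSeries 0
    have h4 := continuous_neumannSeries 1
    fun_prop
  have hGW : ∀ t, t ≠ 0 → G t =
      t * (besselJNat 1 t * besselYNat 0 t - besselJNat 0 t * besselYNat 1 t) := by
    intro t ht
    simp only [hG, besselYNat_eq]
    simp [neumannPolar]
    field_simp
    ring
  have hder : ∀ t, t ≠ 0 → HasDerivAt G 0 t := by
    intro t ht
    have e1 := hasDerivAt_besselJNat 0 ht
    have e2 := hasDerivAt_besselYNat 0 ht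
    have e3 := hasDerivAt_besselJNat_succ 0 ht
    have e4 := hasDerivAt_besselYNat_succ 0 ht
    have h := (hasDerivAt_id' t).mul ((e3.mul e2).sub (e1.mul e4))
    refine (h.congr_deriv ?_).congr_of_eventuallyEq ?_
    · simp; field_simp; ring
    · filter_upwards [isOpen_ne.mem_nhds ht] with u hu
      rw [hGW u hu]; rfl
  -- Continuity at 0 extends the zero derivative across the origin, so the two half-lines share one
  -- constant.
  have hder' := hasDerivAt_of_hasDerivAt_of_ne' (g := fun _ => 0) (x := 0) hder
    hGc.continuousAt continuousAt_const
  rw [← hGW t ht, is_const_of_deriv_eq_zero (fun y => (hder' y).differentiableAt)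
    (fun y => (hder' y).deriv) t 0]
  simp [hG, besselJNat_zero_zero]

/-! ### Recurrences for all integer orders -/

/-- The two first order recurrences satisfied by the functions `J_n` and `Y_n`, `n ≥ 0`. -/
structure BesselRecurrence (z : ℕ → ℝ → ℝ) : Prop where
  hasDerivAt : ∀ n t, t ≠ 0 → HasDerivAt (z n) (n / t * z n t - z (n + 1) t) t
  hasDerivAt_succ : ∀ n t, t ≠ 0 →
    HasDerivAt (z (n + 1)) (z n t - (n + 1) / t * z (n + 1) t) t

lemma besselRecurrence_J : BesselRecurrence besselJNat :=
  ⟨fun n _ => hasDerivAt_besselJNat n, fun n _ => hasDerivAt_besselJNat_succ n⟩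

lemma besselRecurrence_Y : BesselRecurrence besselYNat :=
  ⟨fun n _ => hasDerivAt_besselYNat n, fun n _ => hasDerivAt_besselYNat_succ n⟩

namespace BesselRecurrence

variable {z : ℕ → ℝ → ℝ}

/-- The two recurrences give two expressions for the derivative of `z (n + 1)`; they must coincide.
-/
lemma three_term (hz : BesselRecurrence z) (n : ℕ) {t : ℝ} (ht : t ≠ 0) :
    2 * (n + 1) * z (n + 1) t = t * (z n t + z (n + 2) t) := by
  have h := (hz.hasDerivAt (n + 1) t ht).unique (hz.hasDerivAt_succ n t ht)
  field_simp at h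
  push_cast at h
  linear_combination h

/-- Case distinction on an integer: zero, positive, negative. -/
lemma int_cases {P : ℤ → Prop} (h0 : P 0) (h1 : ∀ m : ℕ, P (m + 1)) (h2 : ∀ m : ℕ, P (-(m + 1))) :
    ∀ n, P n := by
  intro n
  rcases n with n | n
  · rcases n with _ | m
    · exact h0
    · exact_mod_cast h1 m
  · have := h2 n
    rwa [← Int.negSucc_eq] at this

lemma orderSign_natCast (n : ℕ) : orderSign n = 1 := by simp [orderSign]

lemma orderSign_neg_natCast (n : ℕ) : orderSign (-n) = (-1) ^ n := by
  rcases n with _ | n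
  · simp [orderSign]
  · rw [orderSign, if_pos (by push_cast; omega), Int.natAbs_neg, Int.natAbs_natCast]

lemma ext_natCast (z : ℕ → ℝ → ℝ) (n : ℕ) (t : ℝ) :
    orderSign n * z (n : ℤ).natAbs t = z n t := by simp [orderSign_natCast]

lemma ext_neg_natCast (z : ℕ → ℝ → ℝ) (n : ℕ) (t : ℝ) :
    orderSign (-n) * z (-n : ℤ).natAbs t = (-1) ^ n * z n t := by
  simp [orderSign_neg_natCast]

lemma hasDerivAt_int (hz : BesselRecurrence z) (n : ℤ) {t : ℝ} (ht : t ≠ 0) :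
    HasDerivAt (fun t => orderSign n * z n.natAbs t)
      ((orderSign (n - 1) * z (n - 1).natAbs t - orderSign (n + 1) * z (n + 1).natAbs t) / 2) t := by
  refine int_cases (P := fun n => HasDerivAt (fun t => orderSign n * z n.natAbs t)
      ((orderSign (n - 1) * z (n - 1).natAbs t - orderSign (n + 1) * z (n + 1).natAbs t) / 2) t)
      ?_ ?_ ?_ n
  · have e := hz.hasDerivAt 0 t ht
    rw [zero_sub, zero_add]
    have := (e.const_mul (orderSign 0))
    refine this.congr_deriv ?_
    simp [orderSign]
    ring
  · intro m
    have e1 := ext_natCast z m t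
    have e2 := ext_natCast z (m + 2) t
    rw [show (m : ℤ) + 1 - 1 = m by ring, show (m : ℤ) + 1 + 1 = ((m + 2 : ℕ) : ℤ) by push_cast; ring,
      e1, e2]
    have := hz.hasDerivAt_succ m t ht
    have e : (fun t => orderSign (m + 1) * z ((m : ℤ) + 1).natAbs t) = z (m + 1) := by
      ext t; exact_mod_cast ext_natCast z (m + 1) t
    rw [e]
    refine this.congr_deriv ?_
    have h3 := hz.three_term m ht
    field_simp
    linear_combination -h3
  · intro m
    have e1 := ext_neg_natCast z m t
    have e2 := ext_neg_natCast z (m + 2) t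
    rw [show -((m : ℤ) + 1) + 1 = -m by ring,
      show -((m : ℤ) + 1) - 1 = -((m + 2 : ℕ) : ℤ) by push_cast; ring, e1, e2]
    have := (hz.hasDerivAt_succ m t ht).const_mul ((-1) ^ (m + 1))
    have e : (fun t => orderSign (-((m : ℤ) + 1)) * z (-((m : ℤ) + 1)).natAbs t) =
        fun t => (-1) ^ (m + 1) * z (m + 1) t := by
      ext t; exact_mod_cast ext_neg_natCast z (m + 1) t
    rw [e]
    refine this.congr_deriv ?_
    have h3 := hz.three_term m ht
    rw [pow_add, pow_add]
    field_simp
    linear_combination h3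

lemma three_term_int (hz : BesselRecurrence z) (n : ℤ) {t : ℝ} (ht : t ≠ 0) :
    2 * n * (orderSign n * z n.natAbs t) =
      t * (orderSign (n - 1) * z (n - 1).natAbs t + orderSign (n + 1) * z (n + 1).natAbs t) := by
  refine int_cases (P := fun n => 2 * n * (orderSign n * z n.natAbs t) =
      t * (orderSign (n - 1) * z (n - 1).natAbs t + orderSign (n + 1) * z (n + 1).natAbs t))
      ?_ ?_ ?_ n
  · simp [orderSign]
  · intro m
    have e1 := ext_natCast z m t
    have e2 := ext_natCast z (m + 2) t
    have e3 := ext_natCast z (m + 1) t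
    push_cast at e3
    rw [show (m : ℤ) + 1 - 1 = m by ring, show (m : ℤ) + 1 + 1 = ((m + 2 : ℕ) : ℤ) by push_cast; ring,
      e1, e2, e3]
    push_cast
    exact hz.three_term m ht
  · intro m
    have e1 := ext_neg_natCast z m t
    have e2 := ext_neg_natCast z (m + 2) t
    have e3 := ext_neg_natCast z (m + 1) t
    push_cast at e3
    rw [show -((m : ℤ) + 1) + 1 = -m by ring,
      show -((m : ℤ) + 1) - 1 = -((m + 2 : ℕ) : ℤ) by push_cast; ring, e1, e2]
    push_cast
    rw [e3, pow_add, pow_add]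
    linear_combination (-1) ^ m * hz.three_term m ht

end BesselRecurrence

/-! ### Nonvanishing of the Hankel functions and bounds for their inverses -/

/-- The Wronskian `J_{n+1} Y_n - J_n Y_{n+1} = 2 / (π t)`. -/
lemma bessel_wronskian (n : ℕ) {t : ℝ} (ht : t ≠ 0) :
    t * (besselJNat (n + 1) t * besselYNat n t - besselJNat n t * besselYNat (n + 1) t) =
      2 / Real.pi := by
  induction n with
  | zero => exact bessel_wronskian_zero ht
  | succ n ih =>
    rw [← ih]
    linear_combination besselJNat (n + 1) t * besselRecurrence_Y.three_term n ht -
      besselYNat (n + 1) t * besselRecurrence_J.three_term n ht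

lemma abs_orderSign (n : ℤ) : |orderSign n| = 1 := by
  unfold orderSign; split_ifs <;> simp

lemma orderSign_mul_self (n : ℤ) : orderSign n * orderSign n = 1 := by
  rw [← abs_mul_abs_self, abs_orderSign, one_mul]

lemma hankel1_eq (n : ℤ) (t : ℝ) : hankel1 n t =
    orderSign n * (besselJNat n.natAbs t + Complex.I * besselYNat n.natAbs t) := by
  simp only [hankel1, besselJ, besselY]; push_cast; ring

/-- For real argument `J_n` and `Y_n` are the real and imaginary parts up to sign, so a zero of
`H_n` would annihilate the Wronskian. -/
lemma hankel1_ne_zero (n : ℤ) {t : ℝ} (ht : t ≠ 0) : hankel1 n t ≠ 0 := by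
  have hs : (orderSign n : ℂ) ≠ 0 := by
    have := abs_orderSign n
    intro h
    rw [Complex.ofReal_eq_zero] at h
    simp [h] at this
  rw [hankel1_eq]
  refine mul_ne_zero hs fun h => ?_
  have h1 : besselJNat n.natAbs t = 0 := by simpa using congrArg Complex.re h
  have h2 : besselYNat n.natAbs t = 0 := by simpa using congrArg Complex.im h
  have := bessel_wronskian n.natAbs ht
  rw [h1, h2] at this
  have hpi : 2 / Real.pi ≠ 0 := div_ne_zero two_ne_zero Real.pi_ne_zero
  exact hpi (by simpa using this.symm)

lemma abs_besselYNat_le_norm_hankel1 (n : ℤ) (t : ℝ) :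
    |besselYNat n.natAbs t| ≤ ‖hankel1 n t‖ := by
  rw [hankel1_eq, norm_mul, Complex.norm_real, Real.norm_eq_abs, abs_orderSign, one_mul]
  refine le_trans (le_of_eq ?_) (Complex.abs_im_le_norm _)
  simp

/-- High orders are controlled by `|Y_n| ≥ 1`; the finitely many others are absorbed into a sum. -/
lemma exists_norm_inv_hankel1_le {t : ℝ} (ht : 0 < t) :
    ∃ C : ℝ, 0 ≤ C ∧ ∀ n : ℕ, ‖(hankel1 n t)⁻¹‖ ≤ C := by
  obtain ⟨N, hN⟩ := eventually_atTop.1 (eventually_one_le_abs_besselYNat ht)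
  have h0 : 0 ≤ ∑ m ∈ Finset.range N, ‖(hankel1 m t)⁻¹‖ := Finset.sum_nonneg fun _ _ => norm_nonneg _
  refine ⟨1 + ∑ m ∈ Finset.range N, ‖(hankel1 m t)⁻¹‖, by positivity, fun n => ?_⟩
  rcases lt_or_ge n N with h | h
  · have := Finset.single_le_sum (f := fun m : ℕ => ‖(hankel1 m t)⁻¹‖) (fun _ _ => norm_nonneg _)
      (Finset.mem_range.2 h)
    linarith
  · have h1 := (hN n h).trans (abs_besselYNat_le_norm_hankel1 n t)
    rw [norm_inv]
    have := inv_le_one_of_one_le₀ h1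
    linarith

lemma abs_besselJ (n : ℤ) (t : ℝ) : |besselJ n t| = |besselJNat n.natAbs t| := by
  rw [besselJ, abs_mul, abs_orderSign, one_mul]

lemma continuous_besselJ (n : ℤ) : Continuous (besselJ n) :=
  continuous_const.mul (continuous_besselJNat _)

/-- Both sides are continuous, so the formula extends to `t = 0`. The origin is needed as the
initial point of the system in Graf's theorem. -/
lemma hasDerivAt_besselJ (n : ℤ) (t : ℝ) :
    HasDerivAt (besselJ n) ((besselJ (n - 1) t - besselJ (n + 1) t) / 2) t :=
  hasDerivAt_of_hasDerivAt_of_ne' (g := fun t => (besselJ (n - 1) t - besselJ (n + 1) t) / 2)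
    (x := 0) (fun _ hy => besselRecurrence_J.hasDerivAt_int n hy)
    (continuous_besselJ n).continuousAt
    (((continuous_besselJ _).sub (continuous_besselJ _)).div_const 2).continuousAt t

lemma besselJ_zero_zero : besselJ 0 0 = 1 := by
  simp [besselJ, orderSign, besselJNat_zero_zero]

lemma besselJ_ne_zero_zero {n : ℤ} (hn : n ≠ 0) : besselJ n 0 = 0 := by
  have h := abs_besselJNat_le n.natAbs 0
  rw [zero_div, abs_zero, zero_pow (by simpa using hn), mul_zero, zero_mul] at h
  rw [← abs_eq_zero, abs_besselJ]
  exact le_antisymm h (abs_nonneg _)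

/-- A majorant, summable in the order, of `J_n` on `[-2B, 2B]`. -/
lemma abs_besselJ_le (n : ℤ) {t B : ℝ} (h : |t / 2| ≤ B) :
    |besselJ n t| ≤ B ^ n.natAbs / n.natAbs.factorial * Real.exp (B ^ 2) := by
  rw [abs_besselJ]
  refine (abs_besselJNat_le _ t).trans ?_
  have h2 : t ^ 2 / 4 ≤ B ^ 2 := by
    have := pow_le_pow_left₀ (abs_nonneg _) h 2
    rw [sq_abs] at this
    linarith
  have hB : 0 ≤ B := (abs_nonneg _).trans h
  rw [one_div, inv_mul_eq_div]
  gcongr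

/-! ### Cylinder families -/

/-- A family of functions of integer order satisfying the recurrences of the Bessel functions on
the positive half line, with at most factorial growth in the order. -/
structure IsCylinderFamily (Z : ℤ → ℝ → ℂ) : Prop where
  hasDerivAt : ∀ n t, 0 < t → HasDerivAt (Z n) ((Z (n - 1) t - Z (n + 1) t) / 2) t
  three_term : ∀ (n : ℤ) (t : ℝ), 0 < t → 2 * n * Z n t = t * (Z (n - 1) t + Z (n + 1) t)
  bound : ∀ ε R : ℝ, 0 < ε → ∃ C A : ℝ, 0 ≤ C ∧ 1 ≤ A ∧ ∀ (n : ℤ) (t : ℝ), ε ≤ t → t ≤ R →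
    ‖Z n t‖ ≤ C * A ^ n.natAbs * n.natAbs.factorial

lemma isCylinderFamily_besselJ : IsCylinderFamily fun n t => (besselJ n t : ℂ) where
  hasDerivAt n t _ := by exact_mod_cast (hasDerivAt_besselJ n t).ofReal_comp
  three_term n t ht := by exact_mod_cast besselRecurrence_J.three_term_int n ht.ne'
  bound ε R hε := by
    refine ⟨Real.exp ((max 1 (R / 2)) ^ 2), max 1 (R / 2), (Real.exp_pos _).le, le_max_left _ _,
      fun n t h1 h2 => ?_⟩
    rw [Complex.norm_real, Real.norm_eq_abs]
    have hf : (1 : ℝ) ≤ n.natAbs.factorial := by exact_mod_cast n.natAbs.factorial_pos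
    refine (abs_besselJ_le n (B := max 1 (R / 2)) ?_).trans ?_
    · rw [abs_of_pos (by linarith)]
      exact (by linarith : t / 2 ≤ R / 2).trans (le_max_right _ _)
    · have : (0 : ℝ) ≤ max 1 (R / 2) := le_trans zero_le_one (le_max_left _ _)
      rw [mul_comm, mul_assoc]
      gcongr
      rw [div_le_iff₀ (by positivity), mul_assoc]
      exact le_mul_of_one_le_right (by positivity) (by nlinarith)

lemma isCylinderFamily_besselY : IsCylinderFamily fun n t => (besselY n t : ℂ) where
  hasDerivAt n t ht := by
    exact_mod_cast (besselRecurrence_Y.hasDerivAt_int n ht.ne').ofReal_comp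
  three_term n t ht := by exact_mod_cast besselRecurrence_Y.three_term_int n ht.ne'
  bound ε R hε := by
    obtain ⟨C, A, hC, hA, h⟩ := abs_besselYNat_le (R := R) hε
    refine ⟨C, A, hC, hA, fun n t h1 h2 => ?_⟩
    rw [Complex.norm_real, Real.norm_eq_abs, besselY, abs_mul, abs_orderSign, one_mul]
    exact h _ t h1 h2

lemma isCylinderFamily_hankel1 : IsCylinderFamily hankel1 where
  hasDerivAt n t ht := by
    refine ((isCylinderFamily_besselJ.hasDerivAt n t ht).add
      ((isCylinderFamily_besselY.hasDerivAt n t ht).const_mul Complex.I)).congr_deriv ?_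
    simp only [hankel1]; ring
  three_term n t ht := by
    simp only [hankel1]
    linear_combination isCylinderFamily_besselJ.three_term n t ht +
      Complex.I * isCylinderFamily_besselY.three_term n t ht
  bound ε R hε := by
    obtain ⟨C, A, hC, hA, h⟩ := isCylinderFamily_besselJ.bound ε R hε
    obtain ⟨C', A', hC', hA', h'⟩ := isCylinderFamily_besselY.bound ε R hε
    refine ⟨C + C', max A A', by positivity, hA.trans (le_max_left _ _), fun n t h1 h2 => ?_⟩
    have hm1 : A ^ n.natAbs ≤ (max A A') ^ n.natAbs := by gcongr; exact le_max_left _ _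
    have hm2 : A' ^ n.natAbs ≤ (max A A') ^ n.natAbs := by gcongr; exact le_max_right _ _
    calc ‖hankel1 n t‖ ≤ ‖(besselJ n t : ℂ)‖ + ‖(besselY n t : ℂ)‖ := by
          refine (norm_add_le _ _).trans ?_
          rw [norm_mul, Complex.norm_I, one_mul]
      _ ≤ C * (max A A') ^ n.natAbs * n.natAbs.factorial
          + C' * (max A A') ^ n.natAbs * n.natAbs.factorial := by
          refine add_le_add ((h n t h1 h2).trans ?_) ((h' n t h1 h2).trans ?_) <;> gcongr
      _ = _ := by ring

/-! ### Uniqueness for the infinite system of derivative recurrences -/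

/-- A sequence of functions with the derivative recurrence of the cylinder functions,
of at most factorial growth, vanishing at a point, vanishes on a short interval to the right. -/
lemma eq_zero_of_recurrence_local {D : ℤ → ℝ → ℂ} {a R C A : ℝ} (hC : 0 ≤ C) (hA : 1 ≤ A)
    (hD : ∀ m, ∀ ρ ∈ Set.Icc a R, HasDerivAt (D m) ((D (m + 1) ρ - D (m - 1) ρ) / 2) ρ)
    (hb : ∀ m, ∀ ρ ∈ Set.Icc a R, ‖D m ρ‖ ≤ C * A ^ m.natAbs * m.natAbs.factorial)
    (h0 : ∀ m, D m a = 0) {ρ : ℝ} (hρ : ρ ∈ Set.Icc a R) (hρ' : ρ ≤ a + 1 / (4 * A)) (m : ℤ) :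
    D m ρ = 0 := by
  have hA0 : 0 < A := by linarith
  -- Each integration of the system raises the order by at most one and gains a factor from `(ρ -
  -- a)^N / N!`, which offsets the factorial growth in the order.
  have key : ∀ (N : ℕ) (m : ℤ), ∀ ρ ∈ Set.Icc a R, ‖D m ρ‖ ≤
      C * A ^ (m.natAbs + N) * (m.natAbs + N).factorial * ((ρ - a) ^ N / N.factorial) := by
    intro N
    induction N with
    | zero => intro m ρ hρ; simpa using hb m ρ hρ
    | succ N ih =>
      intro m
      set K : ℝ := C * A ^ (m.natAbs + (N + 1)) * (m.natAbs + (N + 1)).factorial with hK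
      have hstep : ∀ k : ℤ, k.natAbs ≤ m.natAbs + 1 → ∀ x ∈ Set.Icc a R,
          ‖D k x‖ ≤ K * ((x - a) ^ N / N.factorial) := by
        intro k hk x hx
        refine (ih k x hx).trans ?_
        have h1 : k.natAbs + N ≤ m.natAbs + (N + 1) := by omega
        have h2 : 0 ≤ (x - a) ^ N / N.factorial := by
          have := sub_nonneg.2 hx.1; positivity
        rw [hK]
        gcongr
      refine image_norm_le_of_norm_deriv_right_le_deriv_boundary
        (f' := fun x => (D (m + 1) x - D (m - 1) x) / 2)
        (B' := fun x => K * ((x - a) ^ N / N.factorial))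
        (fun x hx => (hD m x hx).continuousAt.continuousWithinAt)
        (fun x hx => (hD m x (Set.Ico_subset_Icc_self hx)).hasDerivWithinAt) ?_ ?_ ?_
      · simp [h0 m]
      · intro x
        have h := (((hasDerivAt_id' x).sub_const a).pow (N + 1)).div_const
          ((N + 1).factorial : ℝ)
        refine (h.const_mul K).congr_deriv ?_
        rw [Nat.factorial_succ]
        have : (N : ℝ) + 1 ≠ 0 := by positivity
        push_cast
        field_simp
      · intro x hx
        have hx' := Set.Ico_subset_Icc_self hx
        have e1 := hstep (m + 1) (by omega) x hx'
        have e2 := hstep (m - 1) (by omega) x hx'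
        rw [norm_div, Complex.norm_ofNat]
        have := norm_sub_le (D (m + 1) x) (D (m - 1) x)
        linarith
  have hlim : Tendsto (fun N : ℕ => C * A ^ m.natAbs * (m.natAbs.factorial * 2 ^ m.natAbs) *
      (1 / 2 : ℝ) ^ N) atTop (𝓝 (C * A ^ m.natAbs * (m.natAbs.factorial * 2 ^ m.natAbs) * 0)) :=
    (tendsto_pow_atTop_nhds_zero_of_lt_one (by norm_num) (by norm_num)).const_mul _
  rw [mul_zero] at hlim
  refine norm_le_zero_iff.1 (ge_of_tendsto' hlim fun N => (key N m ρ hρ).trans ?_)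
  -- Bounding the binomial coefficient by `2^{|m|+N}` leaves a geometric sequence of ratio `2A(ρ -
  -- a)`; the length `1/(4A)` makes this at most `1/2`.
  have h1 : ((m.natAbs + N).factorial : ℝ) ≤
      m.natAbs.factorial * N.factorial * 2 ^ (m.natAbs + N) := by
    have e := Nat.add_choose_mul_factorial_mul_factorial m.natAbs N
    have e2 : (m.natAbs + N).choose N ≤ 2 ^ (m.natAbs + N) := Nat.choose_le_two_pow _ _
    have : (m.natAbs + N).factorial ≤ m.natAbs.factorial * N.factorial * 2 ^ (m.natAbs + N) := by
      rw [← e, mul_assoc, mul_comm]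
      exact Nat.mul_le_mul_left _ e2
    exact_mod_cast this
  have h2 : 0 ≤ ρ - a := sub_nonneg.2 hρ.1
  have h3 : A * 2 * (ρ - a) ≤ 1 / 2 := by
    have : ρ - a ≤ 1 / (4 * A) := by linarith
    calc A * 2 * (ρ - a) ≤ A * 2 * (1 / (4 * A)) := by gcongr
      _ = 1 / 2 := by field_simp; norm_num
  calc _ ≤ C * A ^ (m.natAbs + N) * (m.natAbs.factorial * N.factorial * 2 ^ (m.natAbs + N))
        * ((ρ - a) ^ N / N.factorial) := by gcongr
    _ = C * A ^ m.natAbs * (m.natAbs.factorial * 2 ^ m.natAbs) * (A * 2 * (ρ - a)) ^ N := by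
        rw [mul_pow, mul_pow, pow_add, pow_add]; field_simp
    _ ≤ _ := by gcongr

/-- The admissible step `1/(4A)` is the same at every starting point, so finitely many steps cover
the interval. -/
lemma eq_zero_of_recurrence {D : ℤ → ℝ → ℂ} {R C A : ℝ} (hC : 0 ≤ C) (hA : 1 ≤ A)
    (hD : ∀ m, ∀ ρ ∈ Set.Icc 0 R, HasDerivAt (D m) ((D (m + 1) ρ - D (m - 1) ρ) / 2) ρ)
    (hb : ∀ m, ∀ ρ ∈ Set.Icc 0 R, ‖D m ρ‖ ≤ C * A ^ m.natAbs * m.natAbs.factorial)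
    (h0 : ∀ m, D m 0 = 0) {ρ : ℝ} (hρ : ρ ∈ Set.Icc 0 R) (m : ℤ) : D m ρ = 0 := by
  have hδ : 0 < 1 / (4 * A) := by positivity
  have key : ∀ (j : ℕ), ∀ ρ ∈ Set.Icc 0 R, ρ ≤ j * (1 / (4 * A)) → ∀ m, D m ρ = 0 := by
    intro j
    induction j with
    | zero =>
      intro ρ hρ h m
      have : ρ = 0 := le_antisymm (by simpa using h) hρ.1
      rw [this, h0]
    | succ j ih =>
      intro ρ hρ h m
      rcases le_total ρ (j * (1 / (4 * A))) with h' | h'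
      · exact ih ρ hρ h' m
      · have hj : 0 ≤ (j : ℝ) * (1 / (4 * A)) := by positivity
        have sub : ∀ x ∈ Set.Icc ((j : ℝ) * (1 / (4 * A))) R, x ∈ Set.Icc 0 R :=
          fun x hx => ⟨hj.trans hx.1, hx.2⟩
        refine eq_zero_of_recurrence_local hC hA (fun m x hx => hD m x (sub x hx))
          (fun m x hx => hb m x (sub x hx)) (ih _ ⟨hj, h'.trans hρ.2⟩ le_rfl) ⟨h', hρ.2⟩ ?_ m
        push_cast at h
        linarith
  obtain ⟨j, hj⟩ := exists_nat_ge (ρ / (1 / (4 * A)))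
  exact key j ρ hρ ((div_le_iff₀ hδ).1 hj) m

/-! ### Cylindrical waves and their derivatives -/

/-- The cylindrical wave `Z_m(|w|) e^{i m arg w}`. -/
noncomputable def cylWave (Z : ℤ → ℝ → ℂ) (m : ℤ) (w : ℂ) : ℂ := Z m ‖w‖ * (w / ‖w‖) ^ m

lemma norm_cylWave (Z : ℤ → ℝ → ℂ) (m : ℤ) {w : ℂ} (hw : w ≠ 0) :
    ‖cylWave Z m w‖ = ‖Z m ‖w‖‖ := by
  have : ‖w‖ ≠ 0 := norm_ne_zero_iff.2 hw
  rw [cylWave, norm_mul, norm_zpow, norm_div, Complex.norm_real, norm_norm, div_self this,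
    one_zpow, mul_one]

lemma hasDerivAt_norm_sub_ofReal (y : ℂ) (ρ : ℝ) (h : y - ρ ≠ 0) :
    HasDerivAt (fun ρ : ℝ => ‖y - ρ‖) (-(y - ρ).re / ‖y - ρ‖) ρ := by
  have hd : 0 < ‖y - ρ‖ := norm_pos_iff.2 h
  have e : ∀ ρ : ℝ, ‖y - ρ‖ = √((y.re - ρ) ^ 2 + y.im ^ 2) := by
    intro ρ
    rw [Complex.norm_def, Complex.normSq_apply]; simp; ring_nf
  have h1 := ((((hasDerivAt_id' ρ).const_sub y.re).pow 2).add_const (y.im ^ 2)).sqrt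
    (by
      intro h0
      have := e ρ
      simp only [Pi.pow_apply] at h0
      rw [h0, Real.sqrt_zero] at this
      exact hd.ne' this)
  rw [show (fun ρ : ℝ => ‖y - ρ‖) = _ from funext e]
  refine h1.congr_deriv ?_
  simp only [Pi.pow_apply]
  rw [← e]
  simp
  field_simp
  ring

/-- In polar coordinates the derivative has a radial part, given by the derivative recurrence, and
an angular part proportional to `m Z_m / |w|`, which the three-term recurrence rewrites through the
neighbouring orders. -/
lemma IsCylinderFamily.hasDerivAt_cylWave {Z : ℤ → ℝ → ℂ} (hZ : IsCylinderFamily Z) (m : ℤ)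
    (y : ℂ) (ρ : ℝ) (h : y - ρ ≠ 0) :
    HasDerivAt (fun ρ : ℝ => cylWave Z m (y - ρ))
      ((cylWave Z (m + 1) (y - ρ) - cylWave Z (m - 1) (y - ρ)) / 2) ρ := by
  have hd : 0 < ‖y - ρ‖ := norm_pos_iff.2 h
  have hn := hasDerivAt_norm_sub_ofReal y ρ h
  have hw : HasDerivAt (fun ρ : ℝ => y - (ρ : ℂ)) (-1) ρ := by
    simpa using ((hasDerivAt_id' ρ).ofReal_comp).const_sub y
  have hdc : ((‖y - ρ‖ : ℝ) : ℂ) ≠ 0 := by exact_mod_cast hd.ne'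
  have hu := hw.div hn.ofReal_comp hdc
  have hune : (y - ρ) / (‖y - ρ‖ : ℂ) ≠ 0 := div_ne_zero h hdc
  have hz := (hasDerivAt_zpow m _ (Or.inl hune)).comp ρ hu
  have hZ' := HasDerivAt.scomp ρ (hZ.hasDerivAt m _ hd) hn
  refine (hZ'.mul hz).congr_deriv ?_
  have h3 := hZ.three_term m _ hd
  have hnorm : ((‖y - ρ‖ : ℝ) : ℂ) ^ 2 = (y - ρ) * (starRingEnd ℂ) (y - ρ) := by
    rw [Complex.mul_conj, Complex.normSq_eq_norm_sq]; push_cast; rfl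
  have hre : (((y - ρ).re : ℝ) : ℂ) = ((y - ρ) + (starRingEnd ℂ) (y - ρ)) / 2 := by
    rw [Complex.add_conj]; push_cast; ring
  simp only [Function.comp, cylWave, Complex.real_smul, Pi.div_apply]
  push_cast
  rw [zpow_add_one₀ hune, zpow_sub_one₀ hune, hre]
  set w := y - (ρ : ℂ) with hwdef
  set d : ℂ := ((‖w‖ : ℝ) : ℂ) with hddef
  set c := (starRingEnd ℂ) w with hcdef
  -- Eliminating the conjugate by `|w|² = w w̄` leaves a rational identity in `w` and `|w|`.
  have hc : c = d ^ 2 / w := by rw [hnorm]; field_simp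
  generalize (w / d) ^ m = U at *
  generalize Z m ‖w‖ = z0 at *
  generalize Z (m + 1) ‖w‖ = z1 at *
  generalize Z (m - 1) ‖w‖ = z2 at *
  rw [hc]
  field_simp
  linear_combination U * (w ^ 2 - d ^ 2) * h3

lemma intervalIntegral_exp_int (n : ℤ) :
    ∫ t in (-Real.pi)..Real.pi, Complex.exp (n * t * Complex.I) =
      if n = 0 then 2 * (Real.pi : ℂ) else 0 := by
  split_ifs with h
  · simp [h]; ring
  · have hc : (n : ℂ) * Complex.I ≠ 0 := mul_ne_zero (by exact_mod_cast h) Complex.I_ne_zero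
    have := integral_exp_mul_complex (a := -Real.pi) (b := Real.pi) hc
    have e : ∀ t : ℝ, Complex.exp (n * t * Complex.I) = Complex.exp (n * Complex.I * t) := by
      intro t; ring_nf
    simp only [e]
    rw [this, div_eq_zero_iff]
    left
    rw [sub_eq_zero, Complex.exp_eq_exp_iff_exists_int]
    exact ⟨n, by push_cast; ring⟩

/-! ### Graf's addition theorem -/

section Addition

variable {Z : ℤ → ℝ → ℂ} {r : ℝ}

lemma le_norm_circleMap_sub (hr : 0 < r) (t ρ : ℝ) : r - |ρ| ≤ ‖circleMap 0 r t - ρ‖ := by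
  have := norm_sub_norm_le (circleMap 0 r t) ρ
  rwa [norm_circleMap_zero, abs_of_pos hr, Complex.norm_real, Real.norm_eq_abs] at this

lemma norm_circleMap_sub_le (hr : 0 < r) (t ρ : ℝ) : ‖circleMap 0 r t - ρ‖ ≤ r + |ρ| := by
  have := norm_sub_le (circleMap 0 r t) ρ
  rwa [norm_circleMap_zero, abs_of_pos hr, Complex.norm_real, Real.norm_eq_abs] at this

lemma circleMap_sub_ne_zero {t ρ : ℝ} (hρ : |ρ| < r) : circleMap 0 r t - ρ ≠ 0 := by
  have hr : 0 < r := (abs_nonneg _).trans_lt hρ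
  exact norm_pos_iff.1 ((sub_pos.2 hρ).trans_le (le_norm_circleMap_sub hr t ρ))

/-- The `n`-th Fourier coefficient (times `2π`) of a cylindrical wave on a shifted circle. -/
noncomputable def waveCoeff (Z : ℤ → ℝ → ℂ) (r : ℝ) (n m : ℤ) (ρ : ℝ) : ℂ :=
  ∫ t in (-Real.pi)..Real.pi,
    cylWave Z m (circleMap 0 r t - ρ) * Complex.exp ((-n : ℤ) * t * Complex.I)

lemma IsCylinderFamily.continuous_cylWave (hZ : IsCylinderFamily Z) (m : ℤ) {ρ : ℝ}
    (hρ : |ρ| < r) : Continuous fun t => cylWave Z m (circleMap 0 r t - ρ) := by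
  rw [continuous_iff_continuousAt]
  intro t
  have hne := circleMap_sub_ne_zero (t := t) hρ
  have hd : 0 < ‖circleMap 0 r t - ρ‖ := norm_pos_iff.2 hne
  have hc : ContinuousAt (fun t => circleMap 0 r t - (ρ : ℂ)) t :=
    ((continuous_circleMap 0 r).sub continuous_const).continuousAt
  have hdc : ((‖circleMap 0 r t - ρ‖ : ℝ) : ℂ) ≠ 0 := by exact_mod_cast hd.ne'
  exact (ContinuousAt.comp (f := fun t => ‖circleMap 0 r t - (ρ : ℂ)‖)
      (hZ.hasDerivAt m _ hd).continuousAt hc.norm).mul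
    ((hc.div (Complex.continuous_ofReal.continuousAt.comp hc.norm) hdc).zpow₀ m
      (Or.inl (div_ne_zero hne hdc)))

lemma norm_exp_int_mul (n : ℤ) (t : ℝ) : ‖Complex.exp (n * t * Complex.I)‖ = 1 := by
  have := Complex.norm_exp_ofReal_mul_I (n * t)
  push_cast at this
  exact this

/-- The distance from the circle to the shifted centre stays in `[r - R, r + R]`, away from the
singularity at 0. -/
lemma IsCylinderFamily.exists_norm_cylWave_le (hZ : IsCylinderFamily Z) {R : ℝ} (hr : 0 < r)
    (hR : R < r) : ∃ C A : ℝ, 0 ≤ C ∧ 1 ≤ A ∧ ∀ (m : ℤ) (t ρ : ℝ), |ρ| ≤ R →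
      ‖cylWave Z m (circleMap 0 r t - ρ)‖ ≤ C * A ^ m.natAbs * m.natAbs.factorial := by
  obtain ⟨C, A, hC, hA, h⟩ := hZ.bound (r - R) (r + R) (sub_pos.2 hR)
  refine ⟨C, A, hC, hA, fun m t ρ hρ => ?_⟩
  rw [norm_cylWave _ _ (circleMap_sub_ne_zero (hρ.trans_lt hR))]
  exact h m _ (by linarith [le_norm_circleMap_sub hr t ρ])
    (by linarith [norm_circleMap_sub_le hr t ρ])

lemma IsCylinderFamily.hasDerivAt_waveCoeff (hZ : IsCylinderFamily Z) (n m : ℤ) {ρ : ℝ}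
    (hρ : |ρ| < r) :
    HasDerivAt (waveCoeff Z r n m)
      ((waveCoeff Z r n (m + 1) ρ - waveCoeff Z r n (m - 1) ρ) / 2) ρ := by
  have hr : 0 < r := (abs_nonneg _).trans_lt hρ
  obtain ⟨R, hR1, hR2⟩ := exists_between hρ
  obtain ⟨C, A, hC, hA, hb⟩ := hZ.exists_norm_cylWave_le hr hR2
  have hs : Metric.ball (0 : ℝ) R ∈ 𝓝 ρ := Metric.isOpen_ball.mem_nhds (by simpa using hR1)
  have hcE : Continuous fun t : ℝ => Complex.exp ((-n : ℤ) * t * Complex.I) := by fun_prop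
  have hcF : ∀ (m : ℤ) (x : ℝ), |x| < r → Continuous fun t : ℝ =>
      cylWave Z m (circleMap 0 r t - x) * Complex.exp ((-n : ℤ) * t * Complex.I) :=
    fun m x hx => (hZ.continuous_cylWave m hx).mul hcE
  set F' : ℝ → ℝ → ℂ := fun x t =>
    (cylWave Z (m + 1) (circleMap 0 r t - x) - cylWave Z (m - 1) (circleMap 0 r t - x)) / 2
      * Complex.exp ((-n : ℤ) * t * Complex.I) with hF'
  set K := (C * A ^ (m + 1).natAbs * (m + 1).natAbs.factorial
    + C * A ^ (m - 1).natAbs * (m - 1).natAbs.factorial) / 2 with hK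
  have main := intervalIntegral.hasDerivAt_integral_of_dominated_loc_of_deriv_le
    (μ := volume) (a := -Real.pi) (b := Real.pi) (x₀ := ρ) (s := Metric.ball 0 R)
    (F := fun (x : ℝ) t => cylWave Z m (circleMap 0 r t - x) * Complex.exp ((-n : ℤ) * t * Complex.I))
    (F' := F') (bound := fun _ => K) hs ?_ ((hcF m ρ hρ).intervalIntegrable _ _) ?_ ?_
    intervalIntegrable_const ?_
  · refine main.2.congr_deriv ?_
    rw [waveCoeff, waveCoeff, ← intervalIntegral.integral_sub
      ((hcF _ ρ hρ).intervalIntegrable _ _) ((hcF _ ρ hρ).intervalIntegrable _ _),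
      ← intervalIntegral.integral_div]
    refine intervalIntegral.integral_congr fun t _ => ?_
    simp only [hF']; ring
  · filter_upwards [hs] with x hx
    have hx' : |x| < r := by
      have : |x| < R := by simpa using hx
      linarith
    exact (hcF m x hx').aestronglyMeasurable
  · have : Continuous (F' ρ) :=
      (((hZ.continuous_cylWave _ hρ).sub (hZ.continuous_cylWave _ hρ)).div_const 2).mul hcE
    exact this.aestronglyMeasurable
  · refine ae_of_all _ fun t _ x hx => ?_
    have hx' : |x| ≤ R := by
      have : |x| < R := by simpa using hx
      exact this.le
    rw [hF', norm_mul, norm_exp_int_mul, mul_one, norm_div, Complex.norm_ofNat, hK]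
    gcongr
    exact (norm_sub_le _ _).trans (add_le_add (hb _ _ _ hx') (hb _ _ _ hx'))
  · refine ae_of_all _ fun t _ x hx => ?_
    have hx' : |x| < r := by
      have : |x| < R := by simpa using hx
      linarith
    exact (hZ.hasDerivAt_cylWave m _ x (circleMap_sub_ne_zero hx')).mul_const _

lemma waveCoeff_zero (Z : ℤ → ℝ → ℂ) (hr : 0 < r) (n m : ℤ) :
    waveCoeff Z r n m 0 = 2 * Real.pi * (Z n r * besselJ (n - m) 0) := by
  have e : ∀ t : ℝ, cylWave Z m (circleMap 0 r t - (0 : ℝ)) *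
      Complex.exp ((-n : ℤ) * t * Complex.I) =
      Z m r * Complex.exp ((m - n : ℤ) * t * Complex.I) := by
    intro t
    have hrc : (r : ℂ) ≠ 0 := by exact_mod_cast hr.ne'
    have hn : ‖circleMap 0 r t‖ = r := by rw [norm_circleMap_zero, abs_of_pos hr]
    rw [Complex.ofReal_zero, sub_zero, cylWave, hn, circleMap, zero_add,
      mul_div_cancel_left₀ _ hrc, ← Complex.exp_int_mul, mul_assoc, ← Complex.exp_add]
    congr 2
    push_cast; ring
  simp only [waveCoeff, e, intervalIntegral.integral_const_mul, intervalIntegral_exp_int]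
  rcases eq_or_ne m n with rfl | h
  · simp [besselJ_zero_zero]; ring
  · rw [if_neg (sub_ne_zero.2 h), besselJ_ne_zero_zero (sub_ne_zero.2 h.symm)]
    simp

/-- Graf's addition theorem: the Fourier coefficients of `t ↦ Z_0(|r e^{it} - ρ|)`
for `0 ≤ ρ < r` are `Z_n(r) J_n(ρ)`. -/
theorem IsCylinderFamily.addition (hZ : IsCylinderFamily Z) (n : ℤ) {ρ : ℝ} (h0 : 0 ≤ ρ)
    (hρ : ρ < r) :
    ∫ t in (-Real.pi)..Real.pi,
      Z 0 ‖circleMap 0 r t - ρ‖ * Complex.exp ((-n : ℤ) * t * Complex.I) =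
        2 * Real.pi * (Z n r * besselJ n ρ) := by
  have hr : 0 < r := h0.trans_lt hρ
  obtain ⟨C, A, hC, hA, hb⟩ := hZ.exists_norm_cylWave_le hr hρ
  -- Both terms solve the same system: shifting `m` up shifts `n - m` down, which matches the signs
  -- in the derivative of `J`.
  set D : ℤ → ℝ → ℂ := fun m x =>
    waveCoeff Z r n m x - 2 * Real.pi * (Z n r * besselJ (n - m) x) with hD
  set B : ℝ := max 1 (ρ / 2) with hB
  have hB1 : 1 ≤ B := le_max_left _ _
  set C' := 2 * Real.pi * (‖Z n r‖ * (B ^ n.natAbs * Real.exp (B ^ 2))) with hC'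
  have hpi := Real.pi_pos
  have hwb : ∀ m, ∀ x ∈ Set.Icc 0 ρ, ‖waveCoeff Z r n m x‖ ≤
      C * A ^ m.natAbs * m.natAbs.factorial * (2 * Real.pi) := by
    intro m x hx
    have hx' : |x| ≤ ρ := by rw [abs_of_nonneg hx.1]; exact hx.2
    have := intervalIntegral.norm_integral_le_of_norm_le_const (a := -Real.pi) (b := Real.pi)
      (f := fun t : ℝ => cylWave Z m (circleMap 0 r t - x) *
        Complex.exp ((-n : ℤ) * t * Complex.I))
      (C := C * A ^ m.natAbs * m.natAbs.factorial) fun t _ => by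
        rw [norm_mul, norm_exp_int_mul, mul_one]; exact hb m t x hx'
    refine this.trans (le_of_eq ?_)
    rw [abs_of_pos (by linarith)]; ring
  have hJb : ∀ m : ℤ, ∀ x ∈ Set.Icc 0 ρ,
      ‖2 * (Real.pi : ℂ) * (Z n r * besselJ (n - m) x)‖ ≤ C' * B ^ m.natAbs := by
    intro m x hx
    have hj := abs_besselJ_le (n - m) (t := x) (B := B) (by
      rw [abs_of_nonneg (by linarith [hx.1])]
      exact (by linarith [hx.2] : x / 2 ≤ ρ / 2).trans (le_max_right _ _))
    have hf : (1 : ℝ) ≤ (n - m).natAbs.factorial := by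
      exact_mod_cast (n - m).natAbs.factorial_pos
    have hB0 : 0 ≤ B := zero_le_one.trans hB1
    have h2 : B ^ (n - m).natAbs / (n - m).natAbs.factorial ≤ B ^ n.natAbs * B ^ m.natAbs := by
      rw [← pow_add]
      refine (div_le_self (by positivity) hf).trans (pow_le_pow_right₀ hB1 ?_)
      omega
    rw [norm_mul, norm_mul, norm_mul, Complex.norm_real, Complex.norm_real, Complex.norm_ofNat,
      Real.norm_eq_abs, Real.norm_eq_abs, abs_of_pos hpi, hC']
    calc _ ≤ 2 * Real.pi * (‖Z n r‖ * (B ^ n.natAbs * B ^ m.natAbs * Real.exp (B ^ 2))) := by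
          gcongr
          exact hj.trans (by gcongr)
      _ = _ := by ring
  have hzero : D 0 ρ = 0 := by
    refine eq_zero_of_recurrence (D := D) (R := ρ) (C := C * (2 * Real.pi) + C') (A := max A B)
      (by positivity) (hA.trans (le_max_left _ _)) ?_ ?_ ?_ ⟨h0, le_rfl⟩ 0
    · intro m x hx
      have hx' : |x| < r := by rw [abs_of_nonneg hx.1]; linarith [hx.2]
      refine ((hZ.hasDerivAt_waveCoeff n m hx').sub
        (((hasDerivAt_besselJ (n - m) x).ofReal_comp.const_mul (Z n r)).const_mul
          (2 * (Real.pi : ℂ)))).congr_deriv ?_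
      simp only [hD]
      rw [show n - (m + 1) = n - m - 1 by ring, show n - (m - 1) = n - m + 1 by ring]
      push_cast; ring
    · intro m x hx
      have hf : (1 : ℝ) ≤ m.natAbs.factorial := by exact_mod_cast m.natAbs.factorial_pos
      have hm1 : A ^ m.natAbs ≤ (max A B) ^ m.natAbs := by gcongr; exact le_max_left _ _
      have hm2 : B ^ m.natAbs ≤ (max A B) ^ m.natAbs := by gcongr; exact le_max_right _ _
      have hC'0 : 0 ≤ C' := by positivity
      calc ‖D m x‖ ≤ C * A ^ m.natAbs * m.natAbs.factorial * (2 * Real.pi)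
            + C' * B ^ m.natAbs * 1 := by
            rw [mul_one]
            exact (norm_sub_le _ _).trans (add_le_add (hwb m x hx) (hJb m x hx))
        _ ≤ C * (max A B) ^ m.natAbs * m.natAbs.factorial * (2 * Real.pi)
            + C' * (max A B) ^ m.natAbs * m.natAbs.factorial := by gcongr
        _ = _ := by ring
    · intro m
      simp only [hD, waveCoeff_zero Z hr, sub_self]
  have := sub_eq_zero.1 hzero
  rw [sub_zero] at this
  rw [← this, waveCoeff]
  simp [cylWave]

end Addition

/-! ### Neumann's addition theorem for `J_0` -/

lemma norm_circleMap_sub (r ρ t : ℝ) :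
    ‖circleMap 0 r t - ρ‖ = √(r ^ 2 - 2 * r * ρ * Real.cos t + ρ ^ 2) := by
  rw [Complex.norm_def, Complex.normSq_apply]
  congr 1
  simp [circleMap, Complex.exp_ofReal_mul_I_re, Complex.exp_ofReal_mul_I_im]
  linear_combination r ^ 2 * Real.cos_sq_add_sin_sq t

/-- One of the two factorials is discarded; the other already gives summability, uniformly for
arguments bounded by `2B`. -/
lemma abs_besselJ_mul_cos_le {B : ℝ} (a b θ : ℝ) (ha : |a / 2| ≤ B) (hb : |b / 2| ≤ B) (n : ℤ) :
    |besselJ n a * besselJ n b * Real.cos (n * θ)| ≤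
      (B ^ 2) ^ n.natAbs / n.natAbs.factorial * Real.exp (B ^ 2) ^ 2 := by
  have hB : 0 ≤ B := (abs_nonneg _).trans ha
  have hf : (1 : ℝ) ≤ n.natAbs.factorial := by exact_mod_cast n.natAbs.factorial_pos
  rw [abs_mul, abs_mul]
  calc _ ≤ (B ^ n.natAbs / n.natAbs.factorial * Real.exp (B ^ 2)) *
        (B ^ n.natAbs / 1 * Real.exp (B ^ 2)) * 1 := by
        gcongr
        · exact abs_besselJ_le n ha
        · exact (abs_besselJ_le n hb).trans (by gcongr)
        · exact Real.abs_cos_le_one _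
    _ = _ := by rw [← pow_mul, mul_comm 2, pow_mul]; ring

lemma summable_besselJ_mul_cos_majorant (B : ℝ) :
    Summable fun n : ℤ => (B ^ 2) ^ n.natAbs / n.natAbs.factorial * Real.exp (B ^ 2) ^ 2 := by
  refine Summable.mul_right _ (Summable.of_nat_of_neg ?_ ?_) <;>
  · simp only [Int.natAbs_neg, Int.natAbs_natCast]
    exact Real.summable_pow_div_factorial _

lemma summable_besselJ_mul_cos (a b θ : ℝ) :
    Summable fun n : ℤ => besselJ n a * besselJ n b * Real.cos (n * θ) :=
  Summable.of_norm_bounded (summable_besselJ_mul_cos_majorant (max |a / 2| |b / 2|)) fun n =>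
    abs_besselJ_mul_cos_le a b θ (le_max_left _ _) (le_max_right _ _) n

/-- Graf's theorem gives summable Fourier coefficients, so the Fourier series of this continuous
periodic function converges to it at every point; the real part is the cosine series. -/
lemma besselJ_addition_of_lt {r ρ : ℝ} (h0 : 0 ≤ ρ) (hρ : ρ < r) (θ : ℝ) :
    besselJ 0 (√(r ^ 2 - 2 * r * ρ * Real.cos θ + ρ ^ 2)) =
      ∑' n : ℤ, besselJ n r * besselJ n ρ * Real.cos (n * θ) := by
  have : Fact (0 < 2 * Real.pi) := ⟨Real.two_pi_pos⟩
  set F : ℝ → ℂ := fun t => besselJ 0 ‖circleMap 0 r t - ρ‖ with hF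
  have hFc : Continuous F := Complex.continuous_ofReal.comp ((continuous_besselJ 0).comp
    ((continuous_circleMap 0 r).sub continuous_const).norm)
  have hFp : Function.Periodic F (2 * Real.pi) := fun t => by
    simp only [hF, periodic_circleMap 0 r t]
  let f : C(AddCircle (2 * Real.pi), ℂ) := ⟨hFp.lift, continuous_coinduced_dom.2 hFc⟩
  have hcoe : ∀ t : ℝ, f (t : AddCircle (2 * Real.pi)) = F t := fun t => rfl
  have hcoef : ∀ n : ℤ, fourierCoeff f n = besselJ n r * besselJ n ρ := by
    intro n
    rw [fourierCoeff_eq_intervalIntegral f n (-Real.pi),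
      show -Real.pi + 2 * Real.pi = Real.pi by ring]
    have h := isCylinderFamily_besselJ.addition n h0 hρ
    have e : ∀ t : ℝ, fourier (-n) (t : AddCircle (2 * Real.pi)) • f t =
        (besselJ 0 ‖circleMap 0 r t - ρ‖ : ℂ) * Complex.exp ((-n : ℤ) * t * Complex.I) := by
      intro t
      rw [fourier_coe_apply, hcoe, smul_eq_mul, mul_comm]
      congr 2
      have : (Real.pi : ℂ) ≠ 0 := by exact_mod_cast Real.pi_ne_zero
      push_cast
      field_simp
    simp only [e]
    rw [h, Complex.real_smul]
    have : (Real.pi : ℂ) ≠ 0 := by exact_mod_cast Real.pi_ne_zero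
    push_cast
    field_simp
  have hsum : Summable (fourierCoeff f) := by
    have h := summable_besselJ_mul_cos r ρ 0
    simp only [mul_zero, Real.cos_zero, mul_one] at h
    have := Complex.ofRealCLM.summable h
    refine this.congr fun n => ?_
    rw [hcoef]; simp
  have h := has_pointwise_sum_fourier_series_of_summable hsum (θ : AddCircle (2 * Real.pi))
  have hre := (Complex.hasSum_re h)
  rw [hcoe, hF] at hre
  rw [← norm_circleMap_sub, ← (Complex.ofReal_re (besselJ 0 _))]
  refine (hre.tsum_eq.symm.trans (tsum_congr fun n => ?_))
  rw [hcoef, fourier_coe_apply, smul_eq_mul]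
  have e : (2 * (Real.pi : ℂ) * Complex.I * n * θ / (2 * Real.pi : ℝ)) = ((n * θ : ℝ) : ℂ) * Complex.I := by
    have : (Real.pi : ℂ) ≠ 0 := by exact_mod_cast Real.pi_ne_zero
    push_cast
    field_simp
  rw [e, ← Complex.ofReal_mul, Complex.re_ofReal_mul, Complex.exp_ofReal_mul_I_re]

/-- Neumann's addition theorem for `J_0`. -/
theorem besselJ_addition {a b : ℝ} (ha : 0 ≤ a) (hb : 0 ≤ b) (θ : ℝ) :
    besselJ 0 (√(a ^ 2 - 2 * a * b * Real.cos θ + b ^ 2)) =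
      ∑' n : ℤ, besselJ n a * besselJ n b * Real.cos (n * θ) := by
  have main : ∀ {a b : ℝ}, 0 ≤ b → b ≤ a →
      besselJ 0 (√(a ^ 2 - 2 * a * b * Real.cos θ + b ^ 2)) =
        ∑' n : ℤ, besselJ n a * besselJ n b * Real.cos (n * θ) := by
    intro a b hb hab
    set G : ℝ → ℝ := fun x => besselJ 0 (√(x ^ 2 - 2 * x * b * Real.cos θ + b ^ 2)) -
      ∑' n : ℤ, besselJ n x * besselJ n b * Real.cos (n * θ) with hG
    -- Graf's theorem needs `b < x`; continuity up to the endpoint `x = b` supplies equal radii.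
    have hGc : ContinuousOn G (Set.Icc b (a + 1)) := by
      refine ContinuousOn.sub ?_ ?_
      · exact ((continuous_besselJ 0).comp (by fun_prop)).continuousOn
      · refine continuousOn_tsum (u := fun n : ℤ => (((a + 1) / 2) ^ 2) ^ n.natAbs /
          n.natAbs.factorial * Real.exp (((a + 1) / 2) ^ 2) ^ 2)
          (fun n => ?_) (summable_besselJ_mul_cos_majorant ((a + 1) / 2)) fun n x hx => ?_
        · exact (((continuous_besselJ n).mul continuous_const).mul continuous_const).continuousOn
        · refine abs_besselJ_mul_cos_le x b θ ?_ ?_ n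
          · rw [abs_of_nonneg (by linarith [hx.1])]; linarith [hx.2]
          · rw [abs_of_nonneg (by linarith)]; linarith
    have hz : ∀ x ∈ Set.Ioo b (a + 1), G x = 0 := fun x hx =>
      sub_eq_zero.2 (besselJ_addition_of_lt hb hx.1 θ)
    have hcl : Set.Icc b (a + 1) ⊆ closure (Set.Ioo b (a + 1)) := by
      rw [closure_Ioo (by linarith)]
    have := Set.EqOn.of_subset_closure (f := G) (g := fun _ => 0) hz hGc continuousOn_const
      Set.Ioo_subset_Icc_self hcl ⟨hab, by linarith⟩
    exact sub_eq_zero.1 this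
  rcases le_total b a with h | h
  · exact main hb h
  · have := main ha h
    rw [show a ^ 2 - 2 * a * b * Real.cos θ + b ^ 2 = b ^ 2 - 2 * b * a * Real.cos θ + a ^ 2 by ring,
      this]
    exact tsum_congr fun n => by ring

/-! ### Bessel products in the plane and symmetry in the order -/

lemma norm_sub_eq_sqrt (x z : Plane) : ‖x - z‖ =
    √(‖x‖ ^ 2 - 2 * ‖x‖ * ‖z‖ * Real.cos (InnerProductGeometry.angle x z) + ‖z‖ ^ 2) := by
  rw [← Real.sqrt_sq (norm_nonneg (x - z)), norm_sub_sq_real,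
    ← InnerProductGeometry.cos_angle_mul_norm_mul_norm x z]
  congr 2; ring

lemma summable_besselProduct (k : ℝ) (x z : Plane) : Summable (besselProduct k x z) :=
  summable_besselJ_mul_cos _ _ _

lemma tsum_besselProduct {k : ℝ} (hk : 0 < k) (x z : Plane) :
    ∑' n, besselProduct k x z n = besselJ 0 (k * ‖x - z‖) := by
  have h := besselJ_addition (mul_nonneg hk.le (norm_nonneg x)) (mul_nonneg hk.le (norm_nonneg z))
    (InnerProductGeometry.angle x z)
  simp only [besselProduct, cosAngle]
  rw [← h, norm_sub_eq_sqrt]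
  congr 1
  rw [← Real.sqrt_sq hk.le, ← Real.sqrt_mul (sq_nonneg k), Real.sqrt_sq hk.le]
  congr 1; ring

lemma orderSign_neg_mul (n : ℤ) : orderSign (-n) * orderSign (-n) = orderSign n * orderSign n := by
  rw [orderSign_mul_self, orderSign_mul_self]

lemma besselJ_neg_mul (n : ℤ) (a b : ℝ) :
    besselJ (-n) a * besselJ (-n) b = besselJ n a * besselJ n b := by
  simp only [besselJ, Int.natAbs_neg]
  linear_combination (besselJNat n.natAbs a * besselJNat n.natAbs b) * orderSign_neg_mul n

lemma hankel1_neg_mul_besselJ_neg (n : ℤ) (a b : ℝ) :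
    hankel1 (-n) a * besselJ (-n) b = hankel1 n a * besselJ n b := by
  have h : (orderSign (-n) * orderSign (-n) : ℂ) = orderSign n * orderSign n := by
    exact_mod_cast orderSign_neg_mul n
  rw [hankel1_eq, hankel1_eq]
  simp only [besselJ, Int.natAbs_neg]
  push_cast
  linear_combination ((besselJNat n.natAbs a + Complex.I * besselYNat n.natAbs a)
    * besselJNat n.natAbs b : ℂ) * h

lemma besselProduct_neg (k : ℝ) (x z : Plane) (n : ℤ) :
    besselProduct k x z (-n) = besselProduct k x z n := by
  rw [besselProduct, besselJ_neg_mul, besselProduct, cosAngle, cosAngle]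
  push_cast
  rw [neg_mul, Real.cos_neg]

lemma sum_Icc_neg_of_even {f : ℤ → ℝ} (hf : ∀ n, f (-n) = f n) (M : ℕ) :
    ∑ n ∈ Finset.Icc (-(M : ℤ)) M, f n =
      ∑ n ∈ Finset.range (M + 1), (if n = 0 then 1 else 2) * f n := by
  induction M with
  | zero => simp
  | succ M ih =>
    have e : Finset.Icc (-((M + 1 : ℕ) : ℤ)) ((M + 1 : ℕ) : ℤ) =
        insert (-((M + 1 : ℕ) : ℤ)) (insert ((M + 1 : ℕ) : ℤ) (Finset.Icc (-(M : ℤ)) M)) := by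
      ext j; simp only [Finset.mem_Icc, Finset.mem_insert]; push_cast; omega
    rw [e, Finset.sum_insert, Finset.sum_insert, Finset.sum_range_succ, ← ih, hf,
      if_neg (Nat.succ_ne_zero M)]
    · ring
    · simp
    · simp only [Finset.mem_Icc, Finset.mem_insert]; push_cast; omega

/-! ### Polar coordinates -/

section Polar

lemma norm_circlePoint {r : ℝ} (hr : 0 ≤ r) (t : ℝ) : ‖circlePoint r t‖ = r := by
  have h : ‖circlePoint r t 0‖ ^ 2 + ‖circlePoint r t 1‖ ^ 2 = r ^ 2 := by
    simp [circlePoint, mul_pow]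
    linear_combination r ^ 2 * Real.cos_sq_add_sin_sq t
  rw [EuclideanSpace.norm_eq, Fin.sum_univ_two, h, Real.sqrt_sq hr]

lemma inner_circlePoint (a b s t : ℝ) :
    inner ℝ (circlePoint a s) (circlePoint b t) = a * b * Real.cos (s - t) := by
  rw [Real.cos_sub]
  simp [circlePoint, PiLp.inner_apply, Fin.sum_univ_two]
  ring

lemma exists_eq_circlePoint (x : Plane) : ∃ σ, x = circlePoint ‖x‖ σ := by
  set w : ℂ := ⟨x 0, x 1⟩ with hw
  have hn : ‖x‖ = ‖w‖ := by
    rw [EuclideanSpace.norm_eq, Fin.sum_univ_two, Complex.norm_def, Complex.normSq_apply]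
    simp only [Real.norm_eq_abs, sq_abs, hw]
    congr 1; ring
  refine ⟨w.arg, ?_⟩
  rw [hn]
  ext i
  fin_cases i
  · simp [circlePoint, Complex.norm_mul_cos_arg, hw]
  · simp [circlePoint, Complex.norm_mul_sin_arg, hw]

lemma continuous_circlePoint (r : ℝ) : Continuous (circlePoint r) := by
  unfold circlePoint
  fun_prop

/-- The unoriented angle agrees with `s - t` only up to sign and multiples of `2π`. Since `cos (nθ)`
is the Chebyshev polynomial `T_n` of `cos θ`, only the cosine of the angle matters. -/
lemma cosAngle_circlePoint {a b : ℝ} (ha : 0 < a) (hb : 0 < b) (n : ℤ) (s t : ℝ) :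
    cosAngle n (circlePoint a s) (circlePoint b t) = Real.cos (n * (s - t)) := by
  rw [cosAngle, ← Polynomial.Chebyshev.T_real_cos, ← Polynomial.Chebyshev.T_real_cos,
    InnerProductGeometry.cos_angle, inner_circlePoint, norm_circlePoint ha.le,
    norm_circlePoint hb.le]
  congr 1
  field_simp

/-- At the origin the angle is a conventional value, but there `J_n` vanishes for `n ≠ 0`, and for
`n = 0` both cosines are 1. -/
lemma besselJ_mul_cosAngle_circlePoint {k a r : ℝ} (ha : 0 ≤ a) (hr : 0 < r) (n : ℤ) (s t : ℝ) :
    besselJ n (k * a) * cosAngle n (circlePoint a s) (circlePoint r t) =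
      besselJ n (k * a) * Real.cos (n * (s - t)) := by
  rcases ha.eq_or_lt with rfl | ha
  · rcases eq_or_ne n 0 with rfl | hn
    · simp [cosAngle]
    · simp [besselJ_ne_zero_zero hn]
  · rw [cosAngle_circlePoint ha hr]

lemma cosAngle_comm (n : ℤ) (x y : Plane) : cosAngle n x y = cosAngle n y x := by
  rw [cosAngle, cosAngle, InnerProductGeometry.angle_comm]

lemma mul_norm_circlePoint_sub {k r ρ : ℝ} (hk : 0 ≤ k) (s t : ℝ) :
    k * ‖circlePoint ρ s - circlePoint r t‖ =
      ‖circleMap 0 (k * r) (t - s) - (k * ρ : ℝ)‖ := by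
  have h : ‖circlePoint ρ s - circlePoint r t‖ ^ 2 =
      r ^ 2 - 2 * r * ρ * Real.cos (t - s) + ρ ^ 2 := by
    rw [norm_sub_sq_real, inner_circlePoint, ← real_inner_self_eq_norm_sq,
      ← real_inner_self_eq_norm_sq, inner_circlePoint, inner_circlePoint, ← neg_sub t s,
      Real.cos_neg]
    simp; ring
  rw [norm_circleMap_sub, ← Real.sqrt_sq (mul_nonneg hk (norm_nonneg _)), mul_pow, h]
  congr 1; ring

end Polar

/-! ### Measurability and integration on the circle -/

section Measurability

lemma measurable_besselY_zero : Measurable (besselY 0) := by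
  have e : besselY 0 = fun t => 2 / Real.pi * (Real.log (t / 2) + Real.eulerMascheroniConstant)
      * besselJNat 0 t - 1 / Real.pi * neumannSeries 0 t := by
    ext t
    simp [besselY, orderSign, besselYNat_eq, neumannPolar]
  rw [e]
  have h1 := (continuous_besselJNat 0).measurable
  have h2 := (continuous_neumannSeries 0).measurable
  fun_prop

lemma measurable_fundSol (k : ℝ) (x : Plane) : Measurable (fundSol k x) := by
  have h1 := (continuous_besselJ 0).measurable
  have h2 := measurable_besselY_zero
  unfold fundSol hankel1
  fun_prop

lemma measurable_cosAngle (n : ℤ) (z : Plane) : Measurable fun y => cosAngle n y z := by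
  unfold cosAngle InnerProductGeometry.angle
  fun_prop

instance (r : ℝ) : IsFiniteMeasure (arcLength r) := by
  have := Measure.isFiniteMeasure_map (volume.restrict (Set.Ioc (-Real.pi) Real.pi))
    (circlePoint r)
  exact Measure.smul_finite _ ENNReal.ofReal_ne_top

lemma ae_norm_eq_arcLength {r : ℝ} (hr : 0 ≤ r) : ∀ᵐ y ∂(arcLength r), ‖y‖ = r := by
  refine Measure.ae_smul_measure ?_ _
  rw [ae_map_iff (continuous_circlePoint r).aemeasurable
    (measurableSet_eq_fun measurable_norm measurable_const)]
  exact ae_of_all _ fun t => norm_circlePoint hr t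

lemma integral_arcLength {r : ℝ} (hr : 0 ≤ r) {f : Plane → ℂ} (hf : Measurable f) :
    ∫ y, f y ∂(arcLength r) = r * ∫ t in (-Real.pi)..Real.pi, f (circlePoint r t) := by
  rw [arcLength, integral_smul_measure, ENNReal.toReal_ofReal hr,
    integral_map (continuous_circlePoint r).aemeasurable hf.aestronglyMeasurable,
    intervalIntegral.integral_of_le (by linarith [Real.pi_pos]), Complex.real_smul]

lemma fundSol_circlePoint {k ρ r : ℝ} (hk : 0 ≤ k) (s t : ℝ) :
    fundSol k (circlePoint ρ s) (circlePoint r t) =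
      Complex.I / 4 * hankel1 0 ‖circleMap 0 (k * r) (t - s) - (k * ρ : ℝ)‖ := by
  rw [fundSol, mul_norm_circlePoint_sub hk]

lemma continuous_hankel1_circleMap {a b : ℝ} (ha : 0 ≤ a) (hab : a < b) :
    Continuous fun t => hankel1 0 ‖circleMap 0 b t - a‖ := by
  have := isCylinderFamily_hankel1.continuous_cylWave 0 (ρ := a) (r := b)
    (by rwa [abs_of_nonneg ha])
  simpa [cylWave] using this

lemma integrable_fundSol {k r : ℝ} (hk : 0 < k) {x : Plane} (hx : ‖x‖ < r) :
    Integrable (fundSol k x) (arcLength r) := by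
  obtain ⟨σ, hσ⟩ := exists_eq_circlePoint x
  refine Integrable.smul_measure ?_ ENNReal.ofReal_ne_top
  rw [integrable_map_measure (measurable_fundSol k x).aestronglyMeasurable
    (continuous_circlePoint r).aemeasurable]
  have hc : Continuous (fundSol k x ∘ circlePoint r) := by
    rw [hσ]
    have h := continuous_hankel1_circleMap (mul_nonneg hk.le (norm_nonneg x))
      (mul_lt_mul_of_pos_left hx hk)
    have h2 : (fundSol k (circlePoint ‖x‖ σ) ∘ circlePoint r) = fun t =>
        Complex.I / 4 * hankel1 0 ‖circleMap 0 (k * r) (t - σ) - (k * ‖x‖ : ℝ)‖ :=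
      funext fun t => fundSol_circlePoint hk.le σ t
    rw [h2]
    exact continuous_const.mul (h.comp (continuous_id.sub continuous_const))
  exact (hc.integrableOn_Icc (μ := volume)).mono_set Set.Ioc_subset_Icc_self

/-- The cosine splits into two exponentials, whose Graf coefficients of orders `n` and `-n` agree by
`hn`; the rotation by `σ` is removed by periodicity. -/
lemma IsCylinderFamily.integral_cos {Z : ℤ → ℝ → ℂ} (hZ : IsCylinderFamily Z)
    {a b : ℝ} (ha : 0 ≤ a) (hab : a < b) (n : ℤ)
    (hn : Z (-n) b * besselJ (-n) a = Z n b * besselJ n a) (σ τ : ℝ) :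
    ∫ t in (-Real.pi)..Real.pi, Z 0 ‖circleMap 0 b (t - σ) - a‖ * Real.cos (n * (t - τ)) =
      2 * Real.pi * (Z n b * besselJ n a) * Real.cos (n * (σ - τ)) := by
  set F : ℝ → ℂ := fun t => Z 0 ‖circleMap 0 b t - a‖ with hF
  have hFc : Continuous F := by
    have := hZ.continuous_cylWave 0 (ρ := a) (r := b) (by rwa [abs_of_nonneg ha])
    simpa [cylWave] using this
  set G : ℝ → ℂ := fun t => F t * Real.cos (n * (t + (σ - τ))) with hG
  have hGp : Function.Periodic G (2 * Real.pi) := fun t => by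
    simp only [hG, hF, periodic_circleMap 0 b t]
    congr 2
    rw [show n * (t + 2 * Real.pi + (σ - τ)) = n * (t + (σ - τ)) + n * (2 * Real.pi) by ring,
      Real.cos_add_int_mul_two_pi]
  have h1 : ∫ t in (-Real.pi)..Real.pi, Z 0 ‖circleMap 0 b (t - σ) - a‖ * Real.cos (n * (t - τ)) =
      ∫ t in (-Real.pi)..Real.pi, G t := by
    have e := hGp.intervalIntegral_add_eq (-Real.pi - σ) (-Real.pi)
    rw [show -Real.pi + 2 * Real.pi = Real.pi by ring,
      show -Real.pi - σ + 2 * Real.pi = Real.pi - σ by ring,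
      ← intervalIntegral.integral_comp_sub_right] at e
    rw [← e]
    refine intervalIntegral.integral_congr fun t _ => ?_
    simp only [hG, hF]
    rw [show t - σ + (σ - τ) = t - τ by ring]
  have h2 : ∀ t, G t =
      F t * Complex.exp ((-(-n) : ℤ) * t * Complex.I) *
        (Complex.exp (n * (σ - τ) * Complex.I) / 2)
      + F t * Complex.exp ((-n : ℤ) * t * Complex.I) *
        (Complex.exp (-(n * (σ - τ)) * Complex.I) / 2) := by
    intro t
    simp only [hG]
    push_cast
    rw [Complex.cos,
      show (n * (t + (σ - τ)) : ℂ) * Complex.I = n * t * Complex.I + n * (σ - τ) * Complex.I by ring,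
      show -(n * (t + (σ - τ)) : ℂ) * Complex.I = -n * t * Complex.I + -(n * (σ - τ)) * Complex.I by
        ring, Complex.exp_add, Complex.exp_add, neg_neg]
    ring
  have hint : ∀ (m : ℤ) (c : ℂ), IntervalIntegrable
      (fun t : ℝ => F t * Complex.exp ((m : ℤ) * t * Complex.I) * c) volume (-Real.pi) Real.pi :=
    fun m c => ((hFc.mul (by fun_prop)).mul continuous_const).intervalIntegrable _ _
  rw [h1]
  simp only [h2]
  rw [intervalIntegral.integral_add (hint _ _) (hint _ _),
    intervalIntegral.integral_mul_const, intervalIntegral.integral_mul_const,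
    hZ.addition (-n) ha hab, hZ.addition n ha hab, hn, Complex.ofReal_cos, Complex.cos]
  push_cast
  ring

/-- Almost everywhere for arc length `|y|` equals `r`, so the Bessel quotient may be taken constant
and only the angle depends on `y`. -/
lemma measurable_densityTerm_circle (k r : ℝ) (z : Plane) (n : ℕ) : Measurable fun y : Plane =>
    4 / (Complex.I * (r : ℂ) * (Real.pi : ℂ) * (1 + if n = 0 then 1 else 0))
    * ((besselJ n (k * ‖z‖) : ℂ) / hankel1 n (k * r)) * (cosAngle n y z : ℂ) :=
  measurable_const.mul (Complex.measurable_ofReal.comp (measurable_cosAngle n z))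

lemma densityTerm_of_norm_eq (k : ℝ) {r : ℝ} (z : Plane) {y : Plane} (hy : ‖y‖ = r) (n : ℕ) :
    densityTerm k z y n =
      4 / (Complex.I * (r : ℂ) * (Real.pi : ℂ) * (1 + if n = 0 then 1 else 0))
    * ((besselJ n (k * ‖z‖) : ℂ) / hankel1 n (k * r)) * (cosAngle n y z : ℂ) := by
  rw [densityTerm, hy]

lemma aestronglyMeasurable_densityTerm (k : ℝ) {r : ℝ} (hr : 0 ≤ r) (z : Plane) (n : ℕ) :
    AEStronglyMeasurable (fun y => densityTerm k z y n) (arcLength r) := by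
  refine (measurable_densityTerm_circle k r z n).aestronglyMeasurable.congr ?_
  filter_upwards [ae_norm_eq_arcLength hr] with y hy
  rw [densityTerm_of_norm_eq k z hy]

lemma exists_norm_densityTerm_le {k r : ℝ} (hk : 0 < k) (hr : 0 < r) (z : Plane) :
    ∃ b : ℕ → ℝ, Summable b ∧ (∀ n, 0 ≤ b n) ∧
      ∀ y : Plane, ‖y‖ = r → ∀ n, ‖densityTerm k z y n‖ ≤ b n := by
  obtain ⟨C, hC, h⟩ := exists_norm_inv_hankel1_le (mul_pos hk hr)
  have hpi := Real.pi_pos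
  set B := |k * ‖z‖ / 2| with hB
  have hB0 : 0 ≤ B := abs_nonneg _
  refine ⟨fun n => B ^ n / n.factorial * (4 / (r * Real.pi) * Real.exp (B ^ 2) * C),
    (Real.summable_pow_div_factorial B).mul_right _, fun n => by positivity, fun y hy n => ?_⟩
  have h1 : ‖(4 : ℂ) / (Complex.I * (r : ℂ) * (Real.pi : ℂ) * (1 + if n = 0 then 1 else 0))‖ ≤
      4 / (r * Real.pi) := by
    rw [norm_div, norm_mul, norm_mul, norm_mul, Complex.norm_I, one_mul, Complex.norm_real,
      Complex.norm_real, Complex.norm_ofNat, Real.norm_eq_abs, Real.norm_eq_abs, abs_of_pos hr,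
      abs_of_pos hpi]
    have h0 : (1 : ℝ) ≤ ‖(1 + if n = 0 then 1 else 0 : ℂ)‖ := by split_ifs <;> norm_num
    exact div_le_div_of_nonneg_left (by norm_num) (by positivity)
      (le_mul_of_one_le_right (by positivity) h0)
  have h2 : ‖(besselJ n (k * ‖z‖) : ℂ)‖ ≤ B ^ n / n.factorial * Real.exp (B ^ 2) := by
    rw [Complex.norm_real, Real.norm_eq_abs]
    exact abs_besselJ_le n le_rfl
  have h3 : ‖(cosAngle n y z : ℂ)‖ ≤ 1 := by
    rw [Complex.norm_real, Real.norm_eq_abs]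
    exact Real.abs_cos_le_one _
  rw [densityTerm_of_norm_eq k z hy, norm_mul, norm_mul, div_eq_mul_inv (besselJ _ _ : ℂ), norm_mul]
  calc _ ≤ 4 / (r * Real.pi) * (B ^ n / n.factorial * Real.exp (B ^ 2) * C) * 1 := by
        gcongr; exact h n
    _ = _ := by ring

lemma summable_densityTerm {k r : ℝ} (hk : 0 < k) (hr : 0 < r) (z : Plane) {y : Plane}
    (hy : ‖y‖ = r) : Summable (densityTerm k z y) := by
  obtain ⟨b, hb, _, h⟩ := exists_norm_densityTerm_le hk hr z
  exact Summable.of_norm_bounded hb (h y hy)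

lemma memLp_density {k r : ℝ} (hk : 0 < k) (hr : 0 < r) (z : Plane) (M : ℕ) :
    MemLp (density k M z) 2 (arcLength r) := by
  obtain ⟨b, hb, hb0, h⟩ := exists_norm_densityTerm_le hk hr z
  refine MemLp.of_bound (Finset.aestronglyMeasurable_fun_sum _ fun n _ =>
    aestronglyMeasurable_densityTerm k hr.le z n) (∑ n ∈ Finset.range (M + 1), b n) ?_
  filter_upwards [ae_norm_eq_arcLength hr.le] with y hy
  exact norm_sum_le_of_le _ fun n _ => h y hy n

lemma memLp_densityInf {k r : ℝ} (hk : 0 < k) (hr : 0 < r) (z : Plane) :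
    MemLp (densityInf k z) 2 (arcLength r) := by
  obtain ⟨b, hb, hb0, h⟩ := exists_norm_densityTerm_le hk hr z
  refine MemLp.of_bound (aestronglyMeasurable_of_tendsto_ae atTop
    (fun M => (memLp_density hk hr z M).aestronglyMeasurable) ?_) (∑' n, b n) ?_
  · filter_upwards [ae_norm_eq_arcLength hr.le] with y hy
    exact (summable_densityTerm hk hr z hy).hasSum.tendsto_sum_nat.comp (tendsto_add_atTop_nat 1)
  · filter_upwards [ae_norm_eq_arcLength hr.le] with y hy
    exact tsum_of_norm_bounded hb.hasSum (h y hy)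

lemma integrable_fundSol_mul_densityTerm {k r : ℝ} (hk : 0 < k) (hr : 0 < r) {x : Plane}
    (hx : ‖x‖ < r) (z : Plane) (n : ℕ) :
    Integrable (fun y => fundSol k x y * densityTerm k z y n) (arcLength r) := by
  obtain ⟨b, hb, hb0, h⟩ := exists_norm_densityTerm_le hk hr z
  refine (integrable_fundSol hk hx).mul_bdd (c := b n)
    (aestronglyMeasurable_densityTerm k hr.le z n) ?_
  filter_upwards [ae_norm_eq_arcLength hr.le] with y hy using h y hy n

lemma integrable_fundSol_mul_density {k r : ℝ} (hk : 0 < k) (hr : 0 < r) {x : Plane}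
    (hx : ‖x‖ < r) (z : Plane) (M : ℕ) :
    Integrable (fun y => fundSol k x y * density k M z y) (arcLength r) := by
  simp only [density, Finset.mul_sum]
  exact integrable_finsetSum _ fun n _ => integrable_fundSol_mul_densityTerm hk hr hx z n

lemma integrable_fundSol_mul_densityInf {k r : ℝ} (hk : 0 < k) (hr : 0 < r) {x : Plane}
    (hx : ‖x‖ < r) (z : Plane) :
    Integrable (fun y => fundSol k x y * densityInf k z y) (arcLength r) := by
  obtain ⟨b, hb, hb0, h⟩ := exists_norm_densityTerm_le hk hr z
  refine (integrable_fundSol hk hx).mul_bdd (c := ∑' n, b n)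
    (memLp_densityInf hk hr z).aestronglyMeasurable ?_
  filter_upwards [ae_norm_eq_arcLength hr.le] with y hy
  exact tsum_of_norm_bounded hb.hasSum (h y hy)

/-! ### The operator applied to the densities -/

lemma opH_densityTerm {k r : ℝ} (hk : 0 < k) (hr : 0 < r) {x : Plane} (hx : ‖x‖ < r) (z : Plane)
    (n : ℕ) : opH k r (fun y => densityTerm k z y n) x =
      (((if n = 0 then 1 else 2) * besselProduct k x z n : ℝ) : ℂ) := by
  obtain ⟨σ, hσ⟩ := exists_eq_circlePoint x
  obtain ⟨τ, hτ⟩ := exists_eq_circlePoint z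
  set ρ := ‖x‖ with hρ
  set ζ := ‖z‖ with hζ
  have hρ0 : 0 ≤ ρ := norm_nonneg _
  have hζ0 : 0 ≤ ζ := norm_nonneg _
  set c : ℂ := 4 / (Complex.I * (r : ℂ) * (Real.pi : ℂ) * (1 + if n = 0 then 1 else 0)) with hc
  have h1 : opH k r (fun y => densityTerm k z y n) x = ∫ y, fundSol k x y *
      (c * ((besselJ n (k * ζ) : ℂ) / hankel1 n (k * r)) * (cosAngle n y z : ℂ))
        ∂(arcLength r) := by
    refine integral_congr_ae ?_
    filter_upwards [ae_norm_eq_arcLength hr.le] with y hy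
    rw [densityTerm_of_norm_eq k z hy]
  have h2 : ∀ t, fundSol k x (circlePoint r t) *
      (c * ((besselJ n (k * ζ) : ℂ) / hankel1 n (k * r)) * (cosAngle n (circlePoint r t) z : ℂ)) =
      Complex.I / 4 * c / hankel1 n (k * r) * besselJ n (k * ζ) *
        (hankel1 0 ‖circleMap 0 (k * r) (t - σ) - (k * ρ : ℝ)‖ * Real.cos ((n : ℤ) * (t - τ))) := by
    intro t
    have e : (besselJ n (k * ζ) * cosAngle n (circlePoint r t) z : ℂ) =
        besselJ n (k * ζ) * Real.cos ((n : ℤ) * (t - τ)) := by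
      have := besselJ_mul_cosAngle_circlePoint (k := k) hζ0 hr n τ t
      rw [← hτ, cosAngle_comm, show (n : ℤ) * (τ - t) = -((n : ℤ) * (t - τ)) by ring,
        Real.cos_neg] at this
      exact_mod_cast this
    rw [hσ, fundSol_circlePoint hk.le]
    linear_combination (Complex.I / 4 * hankel1 0 ‖circleMap 0 (k * r) (t - σ) - (k * ρ : ℝ)‖ *
      c / hankel1 n (k * r)) * e
  have h3 := isCylinderFamily_hankel1.integral_cos (mul_nonneg hk.le hρ0)
    (mul_lt_mul_of_pos_left hx hk) n (hankel1_neg_mul_besselJ_neg n _ _) σ τ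
  have hm : Measurable fun y => fundSol k x y *
      (c * ((besselJ n (k * ζ) : ℂ) / hankel1 n (k * r)) * (cosAngle n y z : ℂ)) :=
    (measurable_fundSol k x).mul (measurable_densityTerm_circle k r z n)
  rw [h1, integral_arcLength hr.le hm]
  simp only [h2]
  rw [intervalIntegral.integral_const_mul, h3]
  -- The constants combine to `(i/4) · r · 2π · 4 / (i r π (1 + δ_{0n})) = 2 / (1 + δ_{0n})`, the
  -- multiplicity of the pair `±n`.
  have hne := hankel1_ne_zero n (mul_pos hk hr).ne'
  have hprod : besselProduct k x z n =
      besselJ n (k * ρ) * besselJ n (k * ζ) * Real.cos ((n : ℤ) * (σ - τ)) := by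
    rw [besselProduct, ← hρ, ← hζ]
    rcases hρ0.eq_or_lt with h0 | h0
    · rw [← h0]
      rcases eq_or_ne n 0 with rfl | hn
      · simp [cosAngle]
      · simp [besselJ_ne_zero_zero (show (n : ℤ) ≠ 0 by exact_mod_cast hn)]
    · rcases hζ0.eq_or_lt with h0' | h0'
      · rw [← h0']
        rcases eq_or_ne n 0 with rfl | hn
        · simp [cosAngle]
        · simp [besselJ_ne_zero_zero (show (n : ℤ) ≠ 0 by exact_mod_cast hn)]
      · rw [hσ, hτ, cosAngle_circlePoint h0 h0']
  rw [hprod]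
  have hrc : (r : ℂ) ≠ 0 := by exact_mod_cast hr.ne'
  have hpi : (Real.pi : ℂ) ≠ 0 := by exact_mod_cast Real.pi_ne_zero
  have hI := Complex.I_ne_zero
  rw [hc]
  push_cast
  split_ifs <;> push_cast <;> field_simp <;> ring

lemma opH_density {k r : ℝ} (hk : 0 < k) (hr : 0 < r) {x : Plane} (hx : ‖x‖ < r) (z : Plane)
    (M : ℕ) : opH k r (density k M z) x =
      ((∑ n ∈ Finset.Icc (-(M : ℤ)) (M : ℤ), besselProduct k x z n : ℝ) : ℂ) := by
  rw [sum_Icc_neg_of_even (besselProduct_neg k x z), Complex.ofReal_sum]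
  simp only [opH, density, Finset.mul_sum]
  rw [integral_finsetSum _ fun n _ => integrable_fundSol_mul_densityTerm hk hr hx z n]
  exact Finset.sum_congr rfl fun n _ => opH_densityTerm hk hr hx z n

lemma hasSum_besselProduct {k : ℝ} (hk : 0 < k) (x z : Plane) :
    HasSum (besselProduct k x z) (besselJ 0 (k * ‖x - z‖)) := by
  rw [← tsum_besselProduct hk]
  exact (summable_besselProduct k x z).hasSum

/-- The density terms have a summable bound uniform on the circle and the kernel is integrable, so
sum and integral may be exchanged. -/
lemma tendsto_opH_density {k r : ℝ} (hk : 0 < k) (hr : 0 < r) {x : Plane} (hx : ‖x‖ < r)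
    (z : Plane) :
    Tendsto (fun M => opH k r (density k M z) x) atTop (𝓝 (opH k r (densityInf k z) x)) := by
  obtain ⟨b, hb, hb0, h⟩ := exists_norm_densityTerm_le hk hr z
  have hsum : Summable fun n => ∫ y, ‖fundSol k x y * densityTerm k z y n‖ ∂(arcLength r) := by
    refine Summable.of_nonneg_of_le (fun n => integral_nonneg fun y => norm_nonneg _) (fun n => ?_)
      (hb.mul_left (∫ y, ‖fundSol k x y‖ ∂(arcLength r)))
    rw [← integral_mul_const]
    refine integral_mono_ae (integrable_fundSol_mul_densityTerm hk hr hx z n).norm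
      ((integrable_fundSol hk hx).norm.mul_const _) ?_
    filter_upwards [ae_norm_eq_arcLength hr.le] with y hy
    rw [norm_mul]
    exact mul_le_mul_of_nonneg_left (h y hy n) (norm_nonneg _)
  have hs := (hasSum_integral_of_summable_integral_norm
    (fun n => integrable_fundSol_mul_densityTerm hk hr hx z n) hsum).tendsto_sum_nat.comp
      (tendsto_add_atTop_nat 1)
  have e : opH k r (densityInf k z) x =
      ∫ y, ∑' n, fundSol k x y * densityTerm k z y n ∂(arcLength r) := by
    simp only [opH, densityInf, tsum_mul_left]
  rw [e]
  refine hs.congr fun M => ?_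
  simp only [opH, density, Finset.mul_sum, Function.comp]
  rw [integral_finsetSum _ fun n _ => integrable_fundSol_mul_densityTerm hk hr hx z n]

lemma opH_densityInf {k r : ℝ} (hk : 0 < k) (hr : 0 < r) {x : Plane} (hx : ‖x‖ < r)
    (z : Plane) : opH k r (densityInf k z) x = (besselJ 0 (k * ‖x - z‖) : ℂ) := by
  refine tendsto_nhds_unique (tendsto_opH_density hk hr hx z) ?_
  simp only [opH_density hk hr hx z]
  exact (Complex.continuous_ofReal.tendsto _).comp
    ((hasSum_besselProduct hk x z).comp Finset.tendsto_Icc_neg)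

/-- The Weierstrass test gives uniform convergence along finite sets of orders; the symmetric
intervals are cofinal among these. -/
lemma tendstoUniformlyOn_besselProduct {k : ℝ} (hk : 0 < k) {S T : Set Plane}
    (hS : Bornology.IsBounded S) (hT : Bornology.IsBounded T) :
    TendstoUniformlyOn
      (fun (M : ℕ) (q : Plane × Plane) =>
        ∑ n ∈ Finset.Icc (-(M : ℤ)) (M : ℤ), besselProduct k q.1 q.2 n)
      (fun q : Plane × Plane => besselJ 0 (k * ‖q.1 - q.2‖)) atTop (T ×ˢ S) := by
  obtain ⟨R, hR⟩ := hS.exists_norm_le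
  obtain ⟨R', hR'⟩ := hT.exists_norm_le
  set B := k * max R R' / 2 with hB
  have hbd : ∀ w : Plane, ‖w‖ ≤ max R R' → |k * ‖w‖ / 2| ≤ B := fun w hw => by
    rw [abs_of_nonneg (by positivity), hB]; gcongr
  have h := tendstoUniformlyOn_tsum (f := fun (n : ℤ) (q : Plane × Plane) =>
    besselProduct k q.1 q.2 n) (s := T ×ˢ S) (summable_besselJ_mul_cos_majorant B)
    fun n q hq => abs_besselJ_mul_cos_le _ _ _
      (hbd _ ((hR' _ hq.1).trans (le_max_right _ _)))
      (hbd _ ((hR _ hq.2).trans (le_max_left _ _))) n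
  simp only [tsum_besselProduct hk] at h
  exact fun u hu => Finset.tendsto_Icc_neg.eventually (h u hu)

end Measurability

/-! ### Assembly of the result -/

theorem mainTheorem6 (k r : ℝ) (hk : 0 < k) (hr : 0 < r) (Ω : Set Plane)
    (hΩ : closure Ω ⊆ Metric.ball (0 : Plane) r) :
    -- the densities are well defined
    (∀ n : ℤ, hankel1 n (k * r) ≠ 0) ∧
    (∀ z : Plane, ∀ y ∈ Metric.sphere (0 : Plane) r, Summable (densityTerm k z y)) ∧
    (∀ (z : Plane) (M : ℕ), MemLp (density k M z) 2 (arcLength r)) ∧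
    (∀ z : Plane, MemLp (densityInf k z) 2 (arcLength r)) ∧
    -- the truncated density
    (∀ (z : Plane) (M : ℕ), ∀ x ∈ frontier Ω,
      Integrable (fun y => fundSol k x y * density k M z y) (arcLength r) ∧
      opH k r (density k M z) x =
        ((∑ n ∈ Finset.Icc (-(M : ℤ)) (M : ℤ), besselProduct k x z n : ℝ) : ℂ)) ∧
    -- the full density
    (∀ z : Plane, ∀ x ∈ frontier Ω,
      Integrable (fun y => fundSol k x y * densityInf k z y) (arcLength r) ∧
      HasSum (fun n : ℤ => (besselProduct k x z n : ℂ)) (opH k r (densityInf k z) x) ∧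
      opH k r (densityInf k z) x = (besselJ 0 (k * ‖x - z‖) : ℂ)) ∧
    -- uniform convergence for `x` in `∂Ω` and `z` in a bounded region
    (∀ S : Set Plane, Bornology.IsBounded S →
      TendstoUniformlyOn
        (fun (M : ℕ) (q : Plane × Plane) => opH k r (density k M q.2) q.1)
        (fun q : Plane × Plane => opH k r (densityInf k q.2) q.1)
        atTop (frontier Ω ×ˢ S) ∧
      TendstoUniformlyOn
        (fun (M : ℕ) (q : Plane × Plane) =>
          ∑ n ∈ Finset.Icc (-(M : ℤ)) (M : ℤ), besselProduct k q.1 q.2 n)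
        (fun q : Plane × Plane => besselJ 0 (k * ‖q.1 - q.2‖))
        atTop (frontier Ω ×ˢ S)) := by

  have hcl : ∀ x ∈ frontier Ω, ‖x‖ < r := fun x hx => by
    simpa using hΩ (frontier_subset_closure hx)
  have hbd : Bornology.IsBounded (frontier Ω) :=
    Metric.isBounded_ball.subset (frontier_subset_closure.trans hΩ)
  refine ⟨fun n => hankel1_ne_zero n (mul_pos hk hr).ne',
    fun z y hy => summable_densityTerm hk hr z (by simpa using hy),
    fun z M => memLp_density hk hr z M, fun z => memLp_densityInf hk hr z,
    fun z M x hx => ⟨integrable_fundSol_mul_density hk hr (hcl x hx) z M,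
      opH_density hk hr (hcl x hx) z M⟩,
    fun z x hx => ⟨integrable_fundSol_mul_densityInf hk hr (hcl x hx) z, ?_,
      opH_densityInf hk hr (hcl x hx) z⟩, fun S hS => ⟨?_, ?_⟩⟩
  · rw [opH_densityInf hk hr (hcl x hx) z]
    exact_mod_cast hasSum_besselProduct hk x z
  · have h := tendstoUniformlyOn_besselProduct hk hS hbd
    rw [Metric.tendstoUniformlyOn_iff] at h ⊢
    intro ε hε
    filter_upwards [h ε hε] with M hM q hq
    rw [opH_densityInf hk hr (hcl _ hq.1), opH_density hk hr (hcl _ hq.1),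
      Complex.dist_eq, ← Complex.ofReal_sub, Complex.norm_real, ← dist_eq_norm]
    exact hM q hq
  · exact tendstoUniformlyOn_besselProduct hk hS hbd
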